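/- Let $\tilde M$ be a Hausdorff real analytic manifold of dimension $m$ without boundary, and let $M\subseteq\tilde M$ be a compact real analytic submanifold with corners of full dimension: every $p\in M$ lies in the domain of an enveloping chart, i.e. a chart $\varphi\colon U\to V\subseteq\mathbb{R}^m$ of $\tilde M$ with $\varphi(U\cap M)=V\cap\mathbb{R}^m_k$ for some $k\le m$, where $\mathbb{R}^m_k=[0,\infty[^k\times\mathbb{R}^{m-k}$. For $0\le j\le m$ let the stratum $\partial^jM$ be the set of $p\in M$ such that exactly $j$ of the first $k$ coordinates of $\varphi(p)$ vanish; it is an $(m-j)$-dimensional submanifold of $\tilde M$ without boundary. Let $g$ be a real analytic Riemannian metric on $\tilde M$ that is boundary respecting: for $j=1,\dots,m$ the stratum $\partial^jM$ is totally geodesic, i.e. every geodesic of $\partial^jM$ with the induced metric is a geodesic of $\tilde M$. Let $\exp\colon\tilde\Omega\to\tilde M$, $\tilde\Omega\subseteq T\tilde M$, be the Riemannian exponential map of $g$ on its natural domain. Fix finitely many enveloping charts $\tilde\varphi_i\colon\tilde U_i\to B_5(0)$ with $\tilde\varphi_i(\tilde U_i\cap M)=B_5(0)\cap\mathbb{R}^m_{k_i}$,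 $i=1,\dots,n$, such that $M\subseteq\bigcup_i\tilde\varphi_i^{-1}(B_1(0))$; here $B_r(0)$ is the open Euclidean ball in $\mathbb{R}^m$. A real analytic vector field $\eta$ on $M$ (a real analytic section of $T\tilde M|_M=TM$) is called stratified if $\eta(p)\in T_p\partial^jM$ whenever $p\in\partial^jM$. Write $\eta_{(i)}=d\tilde\varphi_i\circ\eta\circ\tilde\varphi_i^{-1}$ on $B_5(0)\cap\mathbb{R}^m_{k_i}$, and let $\|\eta_{(i)}\|^1$ be the maximum of the suprema of $\|\eta_{(i)}\|$ and of the operator norm $\|\eta_{(i)}'\|$ over $\overline{B}_1(0)\cap\mathbb{R}^m_{k_i}$. Then there is $\varepsilon_{\mathrm{diff}}>0$, which can be chosen smaller than any prescribed positive bound, such that for every stratified real analytic vector field $\eta$ on $M$ with $\|\eta_{(i)}\|^1<\varepsilon_{\mathrm{diff}}$ for all $i$ the following holds: $\eta(p)\in\tilde\Omega$ for all $p\in M$; the map $\psi_\eta=\exp\circ\eta$ maps $M$ into $M$ and is a real analytic diffeomorphism of $M$ onto $M$ (bijective, with $\psi_\eta$ and its inverse real analytic); and $\psi_\eta(\partial^jM)=\partial^jM$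 and $\psi_\eta(C)=C$ for every $j\in\{0,\dots,m\}$ and every connected component $C$ of $\partial^jM$. -/

import Mathlib

open Set Filter Topology
open scoped Manifold ContDiff ENNReal

noncomputable section

namespace CornerDiff

/-! ### Geodesics in coordinates -/

section Coordinates

variable {F : Type*} [NormedAddCommGroup F] [NormedSpace ℝ F]

/-- The geodesic equation at time `t` for a curve `c` in a coordinate space `F`, where `G x u v` is
the value of the Riemannian metric at the point `x` on the vectors `u`, `v`. This is
`g(c'', w) + Γ(c', c'; w) = 0` for all `w`, with the Christoffel symbols of the first kind
`Γ(u, v; w) = (D_u g(v, w) + D_v g(u, w) - D_w g(u, v)) / 2`. -/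
def GeodesicEq (G : F → F → F → ℝ) (c : ℝ → F) (t : ℝ) : Prop :=
  ∀ w : F,
    G (c t) (deriv (deriv c) t) w
      + fderiv ℝ (fun y => G y (deriv c t) w) (c t) (deriv c t)
      - (1 / 2) * fderiv ℝ (fun y => G y (deriv c t) (deriv c t)) (c t) w = 0

end Coordinates

/-! ### The model corners -/

/-- `[0, ∞[^k × ℝ^(m - k)`. -/
def modelCorner (m k : ℕ) : Set (EuclideanSpace ℝ (Fin m)) :=
  {x | ∀ i : Fin m, i.val < k → 0 ≤ x i}

/-- The index of a point of `[0, ∞[^k × ℝ^(m - k)`: the number of its first `k` coordinates that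
vanish. -/
def cornerIndex {m : ℕ} (k : ℕ) (x : EuclideanSpace ℝ (Fin m)) : ℕ :=
  {i : Fin m | i.val < k ∧ x i = 0}.ncard

/-- The vectors whose `i`-th coordinate vanishes for every `i < k` with `x i = 0`. For `x` in
`[0, ∞[^k × ℝ^(m - k)` this is the tangent space at `x` of the stratum through `x`, and near `x`
this stratum is an open piece of this subspace. -/
def faceSpace {m : ℕ} (k : ℕ) (x : EuclideanSpace ℝ (Fin m)) :
    Submodule ℝ (EuclideanSpace ℝ (Fin m)) where
  carrier := {v | ∀ i : Fin m, i.val < k → x i = 0 → v i = 0}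
  add_mem' := by
    intro a b ha hb i hi hx
    simp [ha i hi hx, hb i hi hx]
  zero_mem' := by
    intro i _ _
    simp
  smul_mem' := by
    intro r a ha i hi hx
    simp [ha i hi hx]

section Manifold

variable {m : ℕ} {X : Type*} [TopologicalSpace X] [ChartedSpace (EuclideanSpace ℝ (Fin m)) X]

/-! ### Submanifolds with corners of full dimension and their strata -/

/-- `φ` is an enveloping chart of `M ⊆ X`: a chart of the real analytic manifold `X` that maps
the part of `M` in its domain onto the part of `[0, ∞[^k × ℝ^(m - k)` in its range. -/
def IsEnvelopingChart (M : Set X) (k : ℕ)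
    (φ : OpenPartialHomeomorph X (EuclideanSpace ℝ (Fin m))) : Prop :=
  k ≤ m ∧ φ ∈ IsManifold.maximalAtlas (𝓡 m) ω X ∧
    φ '' (φ.source ∩ M) = φ.target ∩ modelCorner m k

/-- `X` is an enveloping manifold of `M`, that is, `M` is a real analytic submanifold with corners
of `X` of full dimension. -/
def IsEnveloped (m : ℕ) {X : Type*} [TopologicalSpace X]
    [ChartedSpace (EuclideanSpace ℝ (Fin m)) X] (M : Set X) : Prop :=
  ∀ p ∈ M, ∃ (k : ℕ) (φ : OpenPartialHomeomorph X (EuclideanSpace ℝ (Fin m))),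
    IsEnvelopingChart M k φ ∧ p ∈ φ.source

/-- The `j`-stratum `∂ʲM`: the points of `M` of index `j`. -/
def stratum (m : ℕ) {X : Type*} [TopologicalSpace X]
    [ChartedSpace (EuclideanSpace ℝ (Fin m)) X] (M : Set X) (j : ℕ) : Set X :=
  {p | p ∈ M ∧ ∃ (k : ℕ) (φ : OpenPartialHomeomorph X (EuclideanSpace ℝ (Fin m))),
    IsEnvelopingChart M k φ ∧ p ∈ φ.source ∧ cornerIndex k (φ p) = j}

/-- The tangent space at `p ∈ M` of the stratum of `M` that contains `p`, a subset of `T_p X`. -/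
def stratumTangent (M : Set X) (p : X) : Set (TangentSpace (𝓡 m) p) :=
  {v | ∀ (k : ℕ) (φ : OpenPartialHomeomorph X (EuclideanSpace ℝ (Fin m))),
    IsEnvelopingChart M k φ → p ∈ φ.source →
      (mfderiv (𝓡 m) (𝓡 m) φ p v : EuclideanSpace ℝ (Fin m)) ∈ faceSpace k (φ p)}

/-- `η` (whose values outside `M` are irrelevant) is a real analytic stratified vector field
on `M`. -/
def IsStratifiedField [IsManifold (𝓡 m) ω X] (M : Set X)
    (η : (p : X) → TangentSpace (𝓡 m) p) : Prop :=
  ContMDiffOn (𝓡 m) (𝓡 m).tangent ω (fun p => (⟨p, η p⟩ : TangentBundle (𝓡 m) X)) M ∧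
    ∀ p ∈ M, η p ∈ stratumTangent M p

/-- `f` restricts to a real analytic diffeomorphism of `M` onto itself. -/
def IsAnalyticDiffeoOf (m : ℕ) {X : Type*} [TopologicalSpace X]
    [ChartedSpace (EuclideanSpace ℝ (Fin m)) X] (M : Set X) (f : X → X) : Prop :=
  MapsTo f M M ∧ ContMDiffOn (𝓡 m) (𝓡 m) ω f M ∧
    ∃ h : X → X, MapsTo h M M ∧ ContMDiffOn (𝓡 m) (𝓡 m) ω h M ∧
      (∀ p ∈ M, h (f p) = p) ∧ ∀ p ∈ M, f (h p) = p

/-! ### Local representatives of vector fields and their `C¹` norms -/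

/-- The local representative `dφ ∘ η ∘ φ⁻¹` of a vector field in a chart. -/
def localRep (φ : OpenPartialHomeomorph X (EuclideanSpace ℝ (Fin m)))
    (η : (p : X) → TangentSpace (𝓡 m) p) (x : EuclideanSpace ℝ (Fin m)) :
    EuclideanSpace ℝ (Fin m) :=
  mfderiv (𝓡 m) (𝓡 m) φ (φ.symm x) (η (φ.symm x))

/-- The norm `max (sup ‖f‖, sup ‖f'‖)` over the intersection of the closed ball of radius `r`
around `0` with `[0, ∞[^k × ℝ^(m - k)`, with values in `[0, ∞]`. The derivative `f'` is taken in
`[0, ∞[^k × ℝ^(m - k)` and has the operator norm. -/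
def c1Norm {m : ℕ} (k : ℕ) (r : ℝ)
    (f : EuclideanSpace ℝ (Fin m) → EuclideanSpace ℝ (Fin m)) : ℝ≥0∞ :=
  max (⨆ x ∈ Metric.closedBall (0 : EuclideanSpace ℝ (Fin m)) r ∩ modelCorner m k, ‖f x‖ₑ)
    (⨆ x ∈ Metric.closedBall (0 : EuclideanSpace ℝ (Fin m)) r ∩ modelCorner m k,
      ‖fderivWithin ℝ f (modelCorner m k) x‖ₑ)

/-! ### Real analytic Riemannian metrics, geodesics and the exponential map -/

/-- A real analytic Riemannian metric on `X`. -/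
abbrev AnalyticMetric (m : ℕ) (X : Type*) [TopologicalSpace X]
    [ChartedSpace (EuclideanSpace ℝ (Fin m)) X] [IsManifold (𝓡 m) ω X] :=
  Bundle.ContMDiffRiemannianMetric (𝓡 m) ω (EuclideanSpace ℝ (Fin m))
    (fun p : X => TangentSpace (𝓡 m) p)

variable [IsManifold (𝓡 m) ω X]

/-- The metric that `g` induces on the range of the chart `φ`. -/
def chartMetric (g : AnalyticMetric m X)
    (φ : OpenPartialHomeomorph X (EuclideanSpace ℝ (Fin m)))
    (x u v : EuclideanSpace ℝ (Fin m)) : ℝ :=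
  g.inner (φ.symm x) (mfderiv (𝓡 m) (𝓡 m) φ.symm x u) (mfderiv (𝓡 m) (𝓡 m) φ.symm x v)

/-- `γ` satisfies the geodesic equation of `g` at time `t`, in every chart around `γ t`. -/
def IsGeodesicAt (g : AnalyticMetric m X) (γ : ℝ → X) (t : ℝ) : Prop :=
  ContMDiffAt 𝓘(ℝ, ℝ) (𝓡 m) 2 γ t ∧
    ∀ φ ∈ IsManifold.maximalAtlas (𝓡 m) ω X, γ t ∈ φ.source →
      GeodesicEq (chartMetric g φ) (fun s => φ (γ s)) t

/-- `γ` is, near `t`, a curve in the stratum `∂ʲM` and satisfies at time `t` the geodesic equation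
of the metric that `g` induces on `∂ʲM`. In an enveloping chart `φ` of `M` around `γ t`, the
stratum is near `φ (γ t)` an open piece of the linear subspace `faceSpace k (φ (γ t))`, so `φ` is
there a chart of `∂ʲM` with values in this subspace; the equation is written in this chart. -/
def IsStratumGeodesicAt (g : AnalyticMetric m X) (M : Set X) (j : ℕ) (γ : ℝ → X) (t : ℝ) : Prop :=
  ∃ (k : ℕ) (φ : OpenPartialHomeomorph X (EuclideanSpace ℝ (Fin m))),
    IsEnvelopingChart M k φ ∧ γ t ∈ φ.source ∧
    ∃ c : ℝ → faceSpace k (φ (γ t)),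
      (∀ᶠ s in 𝓝 t, γ s ∈ φ.source ∩ stratum m M j ∧
        φ (γ s) = (c s : EuclideanSpace ℝ (Fin m))) ∧
      ContDiffAt ℝ 2 c t ∧
      GeodesicEq (fun x u v : faceSpace k (φ (γ t)) =>
        chartMetric g φ (x : EuclideanSpace ℝ (Fin m)) (u : EuclideanSpace ℝ (Fin m))
          (v : EuclideanSpace ℝ (Fin m))) c t

/-- The stratum `∂ʲM` is totally geodesic: all geodesics of `∂ʲM`, with the induced metric, are
geodesics of `X`. -/
def StratumTotallyGeodesic (g : AnalyticMetric m X) (M : Set X) (j : ℕ) : Prop :=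
  ∀ (γ : ℝ → X) (a b : ℝ), (∀ t ∈ Ioo a b, IsStratumGeodesicAt g M j γ t) →
    ∀ t ∈ Ioo a b, IsGeodesicAt g γ t

/-- The metric `g` is boundary respecting: the strata `∂ʲM` are totally geodesic for
`j = 1, …, m`. -/
def BoundaryRespecting (g : AnalyticMetric m X) (M : Set X) : Prop :=
  ∀ j : ℕ, 1 ≤ j → j ≤ m → StratumTotallyGeodesic g M j

/-- There is a geodesic `γ`, defined on an open interval that contains `[0, 1]`, with initial
velocity `v` and `γ 1 = q`. -/
def IsExpValue (g : AnalyticMetric m X) (v : TangentBundle (𝓡 m) X) (q : X) : Prop :=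
  ∃ (γ : ℝ → X) (δ : ℝ), 0 < δ ∧ (∀ t ∈ Ioo (-δ) (1 + δ), IsGeodesicAt g γ t) ∧
    tangentMap 𝓘(ℝ, ℝ) (𝓡 m) γ ⟨0, (1 : ℝ)⟩ = v ∧ γ 1 = q

/-- The domain of the Riemannian exponential map. -/
def expDomain (g : AnalyticMetric m X) : Set (TangentBundle (𝓡 m) X) :=
  {v | ∃ q, IsExpValue g v q}

open Classical in
/-- The Riemannian exponential map, extended from its domain by the base point. -/
def riemExp (g : AnalyticMetric m X) (v : TangentBundle (𝓡 m) X) : X :=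
  if hv : ∃ q, IsExpValue g v q then hv.choose else v.proj

/-- The map `ψ_η = exp ∘ η`. -/
def psi (g : AnalyticMetric m X) (η : (p : X) → TangentSpace (𝓡 m) p) (p : X) : X :=
  riemExp g ⟨p, η p⟩

end Manifold

end CornerDiff

end

/-!
The geodesics of `g` are, in a chart, the solutions of `c'' = S c c' c'` for an analytic quadratic
spray `S`. Zero vectors are equilibria with nilpotent linearization, so near them the solution paths
on a fixed time interval around `[0, 1]` are obtained by inverting the analytic operator `u ↦ u -
∫₀ᵗ f(u)` on a space of continuous paths, whose derivative is unipotent. This gives solutions that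
depend analytically on position and velocity and differ from straight lines by a map with a small
Lipschitz constant (`exists_analytic_flow`, `exists_isSprayFlow`); by uniqueness of geodesics they
compute `exp` (`IsSprayFlow.riemExp_eq`).

The geometric hypothesis enters through the stratum of index one: its being totally geodesic means
that the normal component of `S` vanishes on tangent vectors of an open face
(`chartSpray_normal_eq_zero`). By the identity theorem it vanishes on the hyperplane spanned by the
face, near every point of the closed face, and by Grönwall's inequality geodesics that start
tangentially to a face stay in its hyperplane (`IsSprayFlow.coord_eq_zero`).

If `η` is stratified and `C¹`-small, its normal component at `x` is small compared with the distance
`x l` to the face `x l = 0`. Comparison with the geodesic that starts at the projection of the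
initial vector to the face shows that `x l` changes by at most half of itself along the geodesic. So
geodesics stay in the corner and in the stratum of their initial point
(`IsCornerFlow.coord_nonneg_and_eq_zero_iff`), and hence `ψ_η` maps each point into the connected
component of its stratum. The time one map differs from the identity by a contraction, which gives
local injectivity (`IsCornerFlow.injOn`), preimages of all points of the corner near the centre
(`IsCornerFlow.exists_preimage`: the contraction preserves a box in the corner) and the
invertibility of its derivative (`IsAdapted.exists_analytic_extension`).

A compactness argument over `M` makes the estimates uniform, and one over `M × M` gives global
injectivity (`eventually_hasAdaptedChart`, `eventually_injOn_psi`). Preimages exist locally and lie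
in the same stratum, so `ψ_η` is a bijection of `M`, of each stratum and of each component. The
inverse is continuous because `M` is compact and analytic by the inverse function theorem.
-/

noncomputable section

set_option maxSynthPendingDepth 3

namespace CornerDiff

local notation "𝔼[" n "]" => EuclideanSpace ℝ (Fin n)

/-! ### Superposition operators -/

section Superposition

variable {K Y Z : Type*} [TopologicalSpace K] [CompactSpace K]
  [NormedAddCommGroup Y] [NormedSpace ℝ Y] [NormedAddCommGroup Z] [NormedSpace ℝ Z]

/-- The pointwise application of a continuous multilinear map to continuous functions. -/
def pointwiseMultilinear {n : ℕ} (q : ContinuousMultilinearMap ℝ (fun _ : Fin n => Y) Z) :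
    ContinuousMultilinearMap ℝ (fun _ : Fin n => C(K, Y)) C(K, Z) :=
  MultilinearMap.mkContinuous
    { toFun := fun h => ⟨fun t => q fun i => h i t, by fun_prop⟩
      map_update_add' := by
        intro _ h i a b
        ext t
        have key (c : C(K, Y)) : (fun j => Function.update h i c j t)
            = Function.update (fun j => h j t) i (c t) := by
          ext j; by_cases hj : j = i
          · subst hj; simp
          · simp [hj]
        simp only [ContinuousMap.coe_mk, ContinuousMap.add_apply, key]
        exact q.map_update_add _ _ _ _
      map_update_smul' := by
        intro _ h i a b
        ext t
        have key (c : C(K, Y)) : (fun j => Function.update h i c j t)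
            = Function.update (fun j => h j t) i (c t) := by
          ext j; by_cases hj : j = i
          · subst hj; simp
          · simp [hj]
        simp only [ContinuousMap.coe_mk, ContinuousMap.smul_apply, key]
        exact q.map_update_smul _ _ _ _ }
    ‖q‖ fun h => by
      refine (ContinuousMap.norm_le _ (by positivity)).2 fun t => ?_
      refine (q.le_opNorm _).trans ?_
      gcongr with i
      exact (h i).norm_coe_le_norm t

lemma norm_pointwiseMultilinear_le {n : ℕ}
    (q : ContinuousMultilinearMap ℝ (fun _ : Fin n => Y) Z) :
    ‖pointwiseMultilinear (K := K) q‖ ≤ ‖q‖ :=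
  MultilinearMap.mkContinuous_norm_le _ (norm_nonneg _) _

open Classical in
/-- The superposition operator `u ↦ f ∘ u` between spaces of continuous functions, with the value
`0` when `f ∘ u` is not continuous. -/
def superposition (f : Y → Z) (u : C(K, Y)) : C(K, Z) :=
  if h : Continuous (f ∘ u) then ⟨f ∘ u, h⟩ else 0

omit [CompactSpace K] [NormedSpace ℝ Y] [NormedSpace ℝ Z] in
lemma superposition_apply {f : Y → Z} {u : C(K, Y)} (h : Continuous (f ∘ u)) (t : K) :
    superposition f u t = f (u t) := by
  simp [superposition, h]

/-- The superposition operator of an analytic function is analytic at constant functions: its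
power series consists of the pointwise applications of the terms of the given series. -/
theorem analyticAt_superposition [CompleteSpace Z] {f : Y → Z} {y₀ : Y}
    (hf : AnalyticAt ℝ f y₀) :
    AnalyticAt ℝ (superposition (K := K) f) (ContinuousMap.const K y₀) := by
  obtain ⟨p, r, hp⟩ := hf
  refine ⟨fun n => pointwiseMultilinear (p n), r, ?_, hp.r_pos, ?_⟩
  · refine hp.r_le.trans ?_
    exact FormalMultilinearSeries.radius_le_of_le fun n => norm_pointwiseMultilinear_le _
  · intro h hh
    have hht (t : K) : h t ∈ Metric.eball (0 : Y) r := by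
      have h1 : ‖h t‖ₑ ≤ ‖h‖ₑ := by
        rw [enorm_le_iff_norm_le]
        exact h.norm_coe_le_norm t
      simp only [Metric.mem_eball, edist_zero_right] at hh ⊢
      exact lt_of_le_of_lt h1 hh
    have hcont : Continuous (f ∘ (ContinuousMap.const K y₀ + h : C(K, Y))) := by
      refine (hp.continuousOn).comp_continuous (ContinuousMap.continuous _) fun t => ?_
      have := hht t
      simp only [Metric.mem_eball, edist_zero_right] at this ⊢
      simpa [edist_eq_enorm_sub] using this
    have hrad : r ≤ FormalMultilinearSeries.radius
        (fun n => pointwiseMultilinear (K := K) (p n)) :=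
      hp.r_le.trans (FormalMultilinearSeries.radius_le_of_le fun n =>
        norm_pointwiseMultilinear_le _)
    have hs := FormalMultilinearSeries.hasSum
      (fun n => pointwiseMultilinear (K := K) (p n)) (Metric.eball_subset_eball hrad hh)
    convert hs using 1
    ext t
    rw [superposition_apply hcont]
    have h2 := (ContinuousMap.evalCLM ℝ t : C(K, Z) →L[ℝ] Z).hasSum hs
    exact (hp.hasSum (hht t)).unique h2

lemma eventually_superposition_apply {f : Y → Z} {y₀ : Y} (hf : AnalyticAt ℝ f y₀) :
    ∀ᶠ u in 𝓝 (ContinuousMap.const K y₀), ∀ t, superposition f u t = f (u t) := by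
  obtain ⟨ρ, hρ, hb⟩ := Metric.eventually_nhds_iff_ball.1 hf.eventually_continuousAt
  filter_upwards [Metric.ball_mem_nhds _ hρ] with u hu t
  refine superposition_apply (continuous_iff_continuousAt.2 fun s => ?_) t
  refine ContinuousAt.comp (hb _ ?_) u.continuous.continuousAt
  exact lt_of_le_of_lt (ContinuousMap.dist_apply_le_dist (f := u)
    (g := ContinuousMap.const K y₀) s) hu

lemma hasFDerivAt_superposition [CompleteSpace Z] {f : Y → Z} {y₀ : Y}
    (hf : AnalyticAt ℝ f y₀) :
    HasFDerivAt (superposition (K := K) f) ((fderiv ℝ f y₀).compLeftContinuous ℝ K)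
      (ContinuousMap.const K y₀) := by
  have h := (analyticAt_superposition (K := K) hf).differentiableAt.hasFDerivAt
  suffices hD : (fderiv ℝ f y₀).compLeftContinuous ℝ K
      = fderiv ℝ (superposition (K := K) f) (ContinuousMap.const K y₀) by rwa [hD]
  refine ContinuousLinearMap.ext fun u => ContinuousMap.ext fun t => ?_
  have h1 := (ContinuousMap.evalCLM ℝ t : C(K, Z) →L[ℝ] Z).hasFDerivAt.comp _ h
  have h2 : HasFDerivAt (f ∘ (ContinuousMap.evalCLM ℝ t : C(K, Y) →L[ℝ] Y)) _
    (ContinuousMap.const K y₀) := HasFDerivAt.comp (ContinuousMap.const K y₀)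
      (g := f) (g' := fderiv ℝ f y₀)
      hf.differentiableAt.hasFDerivAt (ContinuousMap.evalCLM ℝ t : C(K, Y) →L[ℝ] Y).hasFDerivAt
  have h3 : (f ∘ (ContinuousMap.evalCLM ℝ t : C(K, Y) →L[ℝ] Y)) =ᶠ[𝓝 (ContinuousMap.const K y₀)]
      ((ContinuousMap.evalCLM ℝ t : C(K, Z) →L[ℝ] Z) ∘ superposition f) := by
    filter_upwards [eventually_superposition_apply (K := K) hf] with u hu
    exact (hu t).symm
  exact DFunLike.congr_fun (h2.unique (h1.congr_of_eventuallyEq h3)) u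

end Superposition

/-! ### Analytic dependence on initial values -/

section Flow

variable {Y : Type*} [NormedAddCommGroup Y] [NormedSpace ℝ Y]

/-- The time interval on which geodesics are constructed: a neighbourhood of `[0, 1]`. -/
abbrev TimeInterval : Type := Icc (-1 : ℝ) 2

/-- The extension of a path to all times, constant outside the time interval. -/
def pathExt (u : C(TimeInterval, Y)) (t : ℝ) : Y := u (projIcc (-1) 2 (by norm_num) t)

omit [NormedSpace ℝ Y] in
@[fun_prop]
lemma continuous_pathExt (u : C(TimeInterval, Y)) : Continuous (pathExt u) :=
  u.continuous.comp continuous_projIcc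

variable (Y) in
/-- The Volterra operator `u ↦ ∫₀ᵗ u`. -/
def volterra : C(TimeInterval, Y) →L[ℝ] C(TimeInterval, Y) :=
  LinearMap.mkContinuous
    { toFun := fun u => ⟨fun t => ∫ s in (0 : ℝ)..t, pathExt u s,
        (intervalIntegral.continuous_primitive
          (fun a b => (continuous_pathExt u).intervalIntegrable a b) 0).comp
            continuous_subtype_val⟩
      map_add' := fun u v => by
        ext t
        exact intervalIntegral.integral_add ((continuous_pathExt u).intervalIntegrable _ _)
          ((continuous_pathExt v).intervalIntegrable _ _)
      map_smul' := fun a u => by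
        ext t
        exact intervalIntegral.integral_smul a (pathExt u) }
    2 fun u => by
      refine (ContinuousMap.norm_le _ (by positivity)).2 fun t => ?_
      refine (intervalIntegral.norm_integral_le_of_norm_le_const
        (C := ‖u‖) fun s _ => u.norm_coe_le_norm _).trans ?_
      have h1 := t.2.1
      have h2 := t.2.2
      have h3 : |(t : ℝ) - 0| ≤ 2 := by rw [abs_le]; constructor <;> linarith
      nlinarith [norm_nonneg u]

lemma volterra_apply (u : C(TimeInterval, Y)) (t : TimeInterval) :
    volterra Y u t = ∫ s in (0 : ℝ)..t, pathExt u s := rfl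

lemma volterra_const [CompleteSpace Y] (y : Y) (t : TimeInterval) :
    volterra Y (ContinuousMap.const _ y) t = (t : ℝ) • y := by
  simp [volterra_apply, pathExt]

variable [CompleteSpace Y]

lemma volterra_compLeftContinuous (N : Y →L[ℝ] Y) (u : C(TimeInterval, Y)) :
    volterra Y (N.compLeftContinuous ℝ TimeInterval u)
      = N.compLeftContinuous ℝ TimeInterval (volterra Y u) := by
  ext t
  exact N.intervalIntegral_comp_comm ((continuous_pathExt u).intervalIntegrable _ _)

/-- Analytic dependence on the initial value near an equilibrium `y₀` of `f` with nilpotent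
linearization: the solutions of `y' = f(y)` with initial values near `y₀` exist on the whole time
interval and depend analytically on the initial value, as paths. They are obtained by inverting
`u ↦ u - ∫₀ᵗ f(u)`, whose derivative at the constant path `y₀` is unipotent. -/
theorem exists_analytic_flow {f : Y → Y} {y₀ : Y} (hf : AnalyticAt ℝ f y₀) (h0 : f y₀ = 0)
    (hN : ∀ y, fderiv ℝ f y₀ (fderiv ℝ f y₀ y) = 0) :
    ∃ U : Y → C(TimeInterval, Y), ContDiffAt ℝ ω U y₀ ∧ U y₀ = ContinuousMap.const _ y₀ ∧
      (∀ y t, fderiv ℝ U y₀ y t = y + (t : ℝ) • fderiv ℝ f y₀ y) ∧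
      ∀ᶠ y in 𝓝 y₀, pathExt (U y) 0 = y ∧
        ∀ t ∈ Ioo (-1 : ℝ) 2, HasDerivAt (pathExt (U y)) (f (pathExt (U y) t)) t := by
  set N := fderiv ℝ f y₀ with hNdef
  set JN := (volterra Y).comp (N.compLeftContinuous ℝ TimeInterval) with hJN
  have hJN2 : ∀ u, JN (JN u) = 0 := by
    intro u
    simp only [hJN, ContinuousLinearMap.comp_apply]
    rw [← volterra_compLeftContinuous N (N.compLeftContinuous ℝ TimeInterval u)]
    have : (N.compLeftContinuous ℝ TimeInterval) ((N.compLeftContinuous ℝ TimeInterval)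
      u) = 0 := by
      ext t
      exact hN _
    rw [this, map_zero, map_zero]
  let e : C(TimeInterval, Y) ≃L[ℝ] C(TimeInterval, Y) :=
    ContinuousLinearEquiv.equivOfInverse (ContinuousLinearMap.id ℝ _ - JN)
      (ContinuousLinearMap.id ℝ _ + JN)
      (fun u => by simp [hJN2]) (fun u => by simp [hJN2])
  let Ψ : C(TimeInterval, Y) → C(TimeInterval, Y) := fun u => u - volterra Y (superposition f u)
  set u₀ : C(TimeInterval, Y) := ContinuousMap.const _ y₀ with hu₀
  have hΨ : ContDiffAt ℝ ω Ψ u₀ := by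
    refine contDiffAt_id.sub ?_
    exact (volterra Y).contDiff.contDiffAt.comp _ (analyticAt_superposition hf).contDiffAt
  have hΨ' : HasFDerivAt Ψ (e : C(TimeInterval, Y) →L[ℝ] C(TimeInterval, Y)) u₀ :=
    (hasFDerivAt_id _).sub ((volterra Y).hasFDerivAt.comp _ (hasFDerivAt_superposition hf))
  have hΨ0 : Ψ u₀ = u₀ := by
    have : superposition f u₀ = 0 := by
      ext t
      rw [(eventually_superposition_apply hf).self_of_nhds]
      simpa [hu₀] using h0
    simp [Ψ, this]
  have hω : (ω : WithTop ℕ∞) ≠ 0 := by simp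
  let g := hΨ.localInverse hΨ' hω
  have hg : ContDiffAt ℝ ω g (Ψ u₀) := hΨ.to_localInverse hΨ' hω
  have hg0 : g (Ψ u₀) = u₀ := hΨ.localInverse_apply_image hΨ' hω
  have hgd : HasFDerivAt g (e.symm : C(TimeInterval, Y) →L[ℝ] C(TimeInterval, Y)) (Ψ u₀) :=
    (hΨ.hasStrictFDerivAt' hΨ' hω).to_localInverse.hasFDerivAt
  have hgr : ∀ᶠ w in 𝓝 (Ψ u₀), Ψ (g w) = w :=
    (hΨ.hasStrictFDerivAt' hΨ' hω).eventually_right_inverse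
  rw [hΨ0] at hg hg0 hgd hgr
  let κ : Y →L[ℝ] C(TimeInterval, Y) := ContinuousLinearMap.const ℝ TimeInterval
  have hκ : κ y₀ = u₀ := rfl
  have hU : ContDiffAt ℝ ω (fun y => g (κ y)) y₀ :=
    ContDiffAt.comp y₀ (by rw [hκ]; exact hg) κ.contDiff.contDiffAt
  refine ⟨fun y => g (κ y), hU, hg0, ?_, ?_⟩
  · intro y t
    have h1 : HasFDerivAt (fun y => g (κ y)) _ y₀ :=
      HasFDerivAt.comp y₀ (by rw [hκ]; exact hgd) κ.hasFDerivAt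
    rw [h1.fderiv]
    change (κ y + volterra Y (N.compLeftContinuous ℝ TimeInterval (κ y))) t = _
    have : N.compLeftContinuous ℝ TimeInterval (κ y) = ContinuousMap.const _ (N y) := rfl
    rw [this, ContinuousMap.add_apply, volterra_const]
    rfl
  · have hc : Tendsto κ (𝓝 y₀) (𝓝 u₀) := κ.continuous.tendsto y₀
    have hgc : Tendsto (fun y => g (κ y)) (𝓝 y₀) (𝓝 u₀) := by
      have := hU.continuousAt.tendsto
      rwa [hκ, hg0] at this
    filter_upwards [hc.eventually hgr, hgc.eventually (eventually_superposition_apply hf)]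
      with y h1 h2
    set u := g (κ y)
    have h3 : ∀ t ∈ Icc (-1 : ℝ) 2,
        pathExt u t = y + ∫ s in (0 : ℝ)..t, pathExt (superposition f u) s := by
      intro t ht
      have h4 := DFunLike.congr_fun h1 ⟨t, ht⟩
      have h5 : u ⟨t, ht⟩ - volterra Y (superposition f u) ⟨t, ht⟩ = y := h4
      rw [volterra_apply] at h5
      rw [pathExt, projIcc_of_mem _ ht, ← h5]
      simp
    refine ⟨by simpa using h3 0 (by norm_num), fun t ht => ?_⟩
    have h6 : f (pathExt u t) = pathExt (superposition f u) t := (h2 _).symm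
    rw [h6]
    have h7 : HasDerivAt (fun t => y + ∫ s in (0 : ℝ)..t, pathExt (superposition f u) s)
        (pathExt (superposition f u) t) t :=
      ((continuous_pathExt _).integral_hasStrictDerivAt 0 t).hasDerivAt.const_add y
    refine h7.congr_of_eventuallyEq ?_
    filter_upwards [Ioo_mem_nhds ht.1 ht.2] with s hs
    exact h3 s (Ioo_subset_Icc_self hs)

end Flow

/-! ### Sprays and their flows near the zero section -/

section Spray

variable {F : Type*} [NormedAddCommGroup F] [NormedSpace ℝ F]

/-- The first order vector field on `F × F` of the second order equation `c'' = S c c' c'`. -/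
def sprayField (S : F → F →L[ℝ] F →L[ℝ] F) (z : F × F) : F × F := (z.2, S z.1 z.2 z.2)

lemma contDiffAt_sprayField {S : F → F →L[ℝ] F →L[ℝ] F} {z : F × F} {n : WithTop ℕ∞}
    (hS : ContDiffAt ℝ n S z.1) : ContDiffAt ℝ n (sprayField S) z :=
  contDiffAt_snd.prodMk
    (((hS.comp z contDiffAt_fst).clm_apply contDiffAt_snd).clm_apply contDiffAt_snd)

lemma fderiv_sprayField_zero {S : F → F →L[ℝ] F →L[ℝ] F} {x : F}
    (hS : DifferentiableAt ℝ S x) (δ : F × F) :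
    fderiv ℝ (sprayField S) (x, 0) δ = (δ.2, 0) := by
  have h1 : HasFDerivAt (fun z : F × F => S z.1) ((fderiv ℝ S x).comp
      (ContinuousLinearMap.fst ℝ F F)) (x, 0) :=
    HasFDerivAt.comp (x, (0 : F)) (f := Prod.fst) (g := S) hS.hasFDerivAt hasFDerivAt_fst
  have h2 := hasFDerivAt_snd.prodMk
    ((h1.clm_apply hasFDerivAt_snd).clm_apply (hasFDerivAt_snd (𝕜 := ℝ) (p := (x, (0 : F)))))
  have h3 : HasFDerivAt (sprayField S) _ (x, (0 : F)) := h2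
  rw [h3.fderiv]
  ext <;> simp

/-- `U` assigns to the initial values in the ball of radius `r` around `(x₀, 0)` solutions of
`c'' = S c c' c'` on the time interval, as pairs of position and velocity with values in `W`. They
depend analytically on the initial values and deviate from straight lines only by a contraction. -/
structure IsSprayFlow (S : F → F →L[ℝ] F →L[ℝ] F) (x₀ : F) (W : Set (F × F))
    (U : F × F → C(TimeInterval, F × F)) (r : ℝ) : Prop where
  pos : 0 < r
  contDiffAt : ∀ z ∈ Metric.ball (x₀, 0) r, ContDiffAt ℝ ω U z
  base : ∀ t, pathExt (U (x₀, 0)) t = (x₀, 0)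
  init : ∀ z ∈ Metric.ball (x₀, 0) r, pathExt (U z) 0 = z
  hasDerivAt : ∀ z ∈ Metric.ball (x₀, 0) r, ∀ t ∈ Ioo (-1 : ℝ) 2,
    HasDerivAt (pathExt (U z)) (sprayField S (pathExt (U z) t)) t
  mem : ∀ z ∈ Metric.ball (x₀, 0) r, ∀ t, pathExt (U z) t ∈ W
  lip : ∀ z ∈ Metric.ball (x₀, 0) r, ∀ z' ∈ Metric.ball (x₀, 0) r, ∀ t ∈ Icc (0 : ℝ) 1,
    ‖(pathExt (U z) t).1 - (pathExt (U z') t).1 - (z.1 - z'.1) - t • (z.2 - z'.2)‖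
      ≤ 1 / 4 * ‖z - z'‖

lemma IsSprayFlow.mono {S : F → F →L[ℝ] F →L[ℝ] F} {x₀ : F} {W : Set (F × F)}
    {U : F × F → C(TimeInterval, F × F)} {r r' : ℝ} (h : IsSprayFlow S x₀ W U r)
    (h0 : 0 < r') (hr : r' ≤ r) : IsSprayFlow S x₀ W U r' := by
  have hs := Metric.ball_subset_ball (x := (x₀, (0 : F))) hr
  exact ⟨h0, fun z hz => h.contDiffAt z (hs hz), h.base, fun z hz => h.init z (hs hz),
    fun z hz => h.hasDerivAt z (hs hz), fun z hz => h.mem z (hs hz),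
    fun z hz z' hz' => h.lip z (hs hz) z' (hs hz')⟩

/-- Analytic sprays have analytic flows near the zero section. The strict derivative at `(x₀, 0)` of
the flow is the affine flow `(x, v) ↦ x + t v`, which gives the Lipschitz estimate. -/
theorem exists_isSprayFlow [CompleteSpace F] {S : F → F →L[ℝ] F →L[ℝ] F} {x₀ : F}
    (hS : ContDiffAt ℝ ω S x₀) {W : Set (F × F)} (hW : W ∈ 𝓝 (x₀, (0 : F))) :
    ∃ U r, IsSprayFlow S x₀ W U r := by
  have hd : DifferentiableAt ℝ S x₀ := hS.differentiableAt (by simp)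
  -- The linearization of the spray field at `(x₀, 0)` is `(x, v) ↦ (v, 0)`, so its square is zero.
  obtain ⟨U, hU, hU0, hU', hev⟩ := exists_analytic_flow (f := sprayField S) (y₀ := (x₀, 0))
    (contDiffAt_sprayField (z := (x₀, 0)) hS).analyticAt (by simp [sprayField])
    (fun y => by simp only [fderiv_sprayField_zero hd]; rfl)
  let κ : F →L[ℝ] C(TimeInterval, F) := ContinuousLinearMap.const ℝ TimeInterval
  let L : F × F →L[ℝ] C(TimeInterval, F) := κ.comp (ContinuousLinearMap.fst ℝ F F)
    + ((volterra F).comp κ).comp (ContinuousLinearMap.snd ℝ F F)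
  have hL (z : F × F) (t : TimeInterval) : L z t = z.1 + (t : ℝ) • z.2 := by
    change z.1 + volterra F (ContinuousMap.const _ z.2) t = _
    rw [volterra_const]
  let P : C(TimeInterval, F × F) →L[ℝ] C(TimeInterval, F) :=
    (ContinuousLinearMap.fst ℝ F F).compLeftContinuous ℝ TimeInterval
  have hP (u : C(TimeInterval, F × F)) (t : TimeInterval) : P u t = (u t).1 := rfl
  have hstrict : HasStrictFDerivAt (fun z => P (U z) - L z)
      (0 : F × F →L[ℝ] C(TimeInterval, F)) (x₀, 0) := by
    have h1 : HasStrictFDerivAt U (fderiv ℝ U (x₀, 0)) (x₀, 0) :=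
      hU.hasStrictFDerivAt (by simp)
    have h2 := (P.hasStrictFDerivAt.comp (x₀, (0 : F)) h1).sub
      (L.hasStrictFDerivAt (x := (x₀, (0 : F))))
    convert! h2 using 1
    symm
    rw [sub_eq_zero]
    refine ContinuousLinearMap.ext fun z => ContinuousMap.ext fun t => ?_
    rw [ContinuousLinearMap.comp_apply, hP, hU', fderiv_sprayField_zero hd, hL]
    simp
  obtain ⟨s, hs, hlip⟩ := hstrict.exists_lipschitzOnWith_of_nnnorm_lt (1 / 4) (by simp)
  obtain ⟨ρ, hρ, hρW⟩ := Metric.mem_nhds_iff.1 hW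
  have hnear : ∀ᶠ z in 𝓝 (x₀, (0 : F)), U z ∈ Metric.ball (U (x₀, 0)) ρ :=
    hU.continuousAt.eventually (Metric.ball_mem_nhds _ hρ)
  have hs' : ∀ᶠ z in 𝓝 (x₀, (0 : F)), z ∈ s := hs
  have hall := (((hU.eventually (by simp)).and hev).and hnear).and hs'
  obtain ⟨r, hr, hb⟩ := Metric.eventually_nhds_iff_ball.1 hall
  refine ⟨U, r, hr, fun z hz => (hb z hz).1.1.1,
    fun t => by rw [hU0]; rfl, fun z hz => (hb z hz).1.1.2.1,
    fun z hz => (hb z hz).1.1.2.2, fun z hz t => ?_, fun z hz z' hz' t ht => ?_⟩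
  · apply hρW
    have := (hb z hz).1.2
    rw [hU0] at this
    exact lt_of_le_of_lt (ContinuousMap.dist_apply_le_dist (f := U z)
      (g := ContinuousMap.const _ (x₀, (0 : F))) _) this
  · have h1 := hlip.dist_le_mul z (hb z hz).2 z' (hb z' hz').2
    rw [dist_eq_norm, dist_eq_norm] at h1
    have ht' : t ∈ Icc (-1 : ℝ) 2 := ⟨by linarith [ht.1], by linarith [ht.2]⟩
    have h2 := (ContinuousMap.norm_coe_le_norm (P (U z) - L z - (P (U z') - L z'))
      ⟨t, ht'⟩).trans h1
    simp only [ContinuousMap.sub_apply, hP, hL] at h2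
    simp only [pathExt, projIcc_of_mem _ ht']
    have h3 : (((1 / 4 : NNReal)) : ℝ) = 1 / 4 := by norm_num
    rw [h3] at h2
    refine (le_of_eq (congrArg norm ?_)).trans h2
    rw [smul_sub]
    abel

end Spray

/-! ### The spray of a metric in coordinates -/

section Metric

variable {F : Type*} [NormedAddCommGroup F] [NormedSpace ℝ F]

/-- The trilinear map `(u, v, w) ↦ D w u v`. -/
def rotateForm : (F →L[ℝ] F →L[ℝ] F →L[ℝ] ℝ) →L[ℝ] (F →L[ℝ] F →L[ℝ] F →L[ℝ] ℝ) :=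
  (ContinuousLinearMap.compL ℝ F (F →L[ℝ] F →L[ℝ] ℝ) (F →L[ℝ] F →L[ℝ] ℝ)
    ((ContinuousLinearMap.flipₗᵢ ℝ F F ℝ).toContinuousLinearEquiv :
      (F →L[ℝ] F →L[ℝ] ℝ) →L[ℝ] (F →L[ℝ] F →L[ℝ] ℝ))).comp
    ((ContinuousLinearMap.flipₗᵢ ℝ F F (F →L[ℝ] ℝ)).toContinuousLinearEquiv :
      (F →L[ℝ] F →L[ℝ] F →L[ℝ] ℝ) →L[ℝ] (F →L[ℝ] F →L[ℝ] F →L[ℝ] ℝ))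

lemma rotateForm_apply (D : F →L[ℝ] F →L[ℝ] F →L[ℝ] ℝ) (u v w : F) :
    rotateForm D u v w = D w u v := rfl

/-- The geodesic spray of the metric `A` on `F`: minus the Christoffel symbols of the second
kind, up to symmetrization of the first summand. -/
def metricSpray (A : F → F →L[ℝ] F →L[ℝ] ℝ) (x : F) : F →L[ℝ] F →L[ℝ] F :=
  -(ContinuousLinearMap.compL ℝ F (F →L[ℝ] ℝ) F (A x).inverse).comp
    (fderiv ℝ A x - (1 / 2 : ℝ) • rotateForm (fderiv ℝ A x))

lemma metricSpray_apply (A : F → F →L[ℝ] F →L[ℝ] ℝ) (x u : F) :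
    metricSpray A x u u = -(A x).inverse
      (fderiv ℝ A x u u - (1 / 2 : ℝ) • rotateForm (fderiv ℝ A x) u u) := rfl

variable [FiniteDimensional ℝ F]

lemma isInvertible_of_posDef {B : F →L[ℝ] F →L[ℝ] ℝ} (hB : ∀ v, v ≠ 0 → 0 < B v v) :
    B.IsInvertible := by
  have hinj : Function.Injective B := by
    rw [injective_iff_map_eq_zero]
    intro v hv
    by_contra h
    have := hB v h
    simp [hv] at this
  have hfr : Module.finrank ℝ F = Module.finrank ℝ (F →L[ℝ] ℝ) := by
    rw [(LinearMap.toContinuousLinearMap (𝕜 := ℝ) (E := F) (F' := ℝ)).symm.finrank_eq]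
    exact (Subspace.dual_finrank_eq (K := ℝ) (V := F)).symm
  refine ⟨(LinearEquiv.ofInjectiveOfFinrankEq B.toLinearMap hinj hfr).toContinuousLinearEquiv, ?_⟩
  ext; rfl

lemma contDiffAt_metricSpray {A : F → F →L[ℝ] F →L[ℝ] ℝ} {x : F} (hA : ContDiffAt ℝ ω A x)
    (hpos : ∀ v, v ≠ 0 → 0 < A x v v) : ContDiffAt ℝ ω (metricSpray A) x := by
  have h1 : ContDiffAt ℝ ω (fun y => (A y).inverse) x :=
    ContDiffAt.comp x (isInvertible_of_posDef hpos).contDiffAt_map_inverse hA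
  have h2 : ContDiffAt ℝ ω (fderiv ℝ A) x := hA.fderiv_right (by simp)
  have h3 : ContDiffAt ℝ ω (fun y => fderiv ℝ A y - (1 / 2 : ℝ) • rotateForm (fderiv ℝ A y)) x :=
    h2.sub (((1 / 2 : ℝ) • rotateForm (F := F)).contDiff.contDiffAt.comp x h2)
  exact (((ContinuousLinearMap.compL ℝ F (F →L[ℝ] ℝ) F).contDiff.contDiffAt.comp x
    h1).clm_comp h3).neg

/-- The geodesic equation, solved for the second derivative by inverting the metric. -/
lemma geodesicEq_iff {A : F → F →L[ℝ] F →L[ℝ] ℝ} {G : F → F → F → ℝ} {c : ℝ → F} {t : ℝ}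
    (hG : ∀ᶠ y in 𝓝 (c t), ∀ u w, G y u w = A y u w) (hA : DifferentiableAt ℝ A (c t))
    (hpos : ∀ v, v ≠ 0 → 0 < A (c t) v v) :
    GeodesicEq G c t ↔
      deriv (deriv c) t = metricSpray A (c t) (deriv c t) (deriv c t) := by
  have key (u w : F) : fderiv ℝ (fun y => G y u w) (c t) = ((fderiv ℝ A (c t)).flip u).flip w := by
    have h1 : (fun y => G y u w) =ᶠ[𝓝 (c t)] fun y => A y u w := hG.mono fun y hy => hy u w
    rw [h1.fderiv_eq]
    have h2 := (hA.hasFDerivAt.clm_apply (hasFDerivAt_const u (c t))).clm_apply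
      (hasFDerivAt_const w (c t))
    rw [h2.fderiv]
    ext; simp
  set u := deriv c t
  set a := deriv (deriv c) t
  have hinv := isInvertible_of_posDef hpos
  obtain ⟨e, he⟩ := hinv
  have h1 : GeodesicEq G c t ↔ A (c t) a + (fderiv ℝ A (c t) u u
      - (1 / 2 : ℝ) • rotateForm (fderiv ℝ A (c t)) u u) = 0 := by
    rw [ContinuousLinearMap.ext_iff]
    refine forall_congr' fun w => ?_
    rw [key, key, hG.self_of_nhds]
    simp only [add_apply, sub_apply,
      smul_apply, rotateForm_apply, ContinuousLinearMap.flip_apply,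
      zero_apply, smul_eq_mul]
    rw [add_sub_assoc]
  rw [h1, metricSpray_apply, ← he, ContinuousLinearMap.inverse_equiv, add_eq_zero_iff_eq_neg]
  constructor
  · intro h
    have := congrArg e.symm h
    simpa using this
  · intro h
    rw [h]
    simp

end Metric

/-! ### Invariance of the geodesic equation -/

section Transformation

variable {F : Type*} [NormedAddCommGroup F] [NormedSpace ℝ F]

lemma ContDiffAt.differentiableAt_deriv {c : ℝ → F} {t : ℝ} (hc : ContDiffAt ℝ 2 c t) :
    DifferentiableAt ℝ (deriv c) t := by
  have h : ContDiffAt ℝ 1 (deriv c) t := by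
    have := hc.fderiv_right (m := 1) (by norm_num)
    have h2 : deriv c = fun s => fderiv ℝ c s 1 := by ext s; simp
    rw [h2]
    exact this.clm_apply contDiffAt_const
  exact h.differentiableAt (by simp)

lemma ContDiffAt.eventually_hasDerivAt {c : ℝ → F} {t : ℝ} (hc : ContDiffAt ℝ 2 c t) :
    ∀ᶠ s in 𝓝 t, HasDerivAt c (deriv c s) s := by
  filter_upwards [hc.eventually (by simp)] with s hs
  exact (hs.differentiableAt (by simp)).hasDerivAt

/-- The geodesic equation is invariant under a change of coordinates `τ` that is an isometry from
`G` to `A'`. -/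
theorem GeodesicEq.comp {F' : Type*} [NormedAddCommGroup F'] [NormedSpace ℝ F']
    {G : F → F → F → ℝ} {A' : F' → F' →L[ℝ] F' →L[ℝ] ℝ} {G' : F' → F' → F' → ℝ} {τ : F → F'}
    {c : ℝ → F} {t : ℝ} (hgeo : GeodesicEq G c t) (hc : ContDiffAt ℝ 2 c t)
    (hτ : ContDiffAt ℝ 2 τ (c t)) (hsurj : Function.Surjective (fderiv ℝ τ (c t)))
    (hA' : DifferentiableAt ℝ A' (τ (c t))) (hsymm : ∀ u v, A' (τ (c t)) u v = A' (τ (c t)) v u)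
    (hG' : ∀ᶠ y in 𝓝 (τ (c t)), ∀ u v, G' y u v = A' y u v)
    (hG : ∀ᶠ y in 𝓝 (c t), ∀ u v, G y u v = A' (τ y) (fderiv ℝ τ y u) (fderiv ℝ τ y v)) :
    GeodesicEq G' (fun s => τ (c s)) t := by
  set x := c t with hx
  have hτ1 : ContDiffAt ℝ 1 (fderiv ℝ τ) x := hτ.fderiv_right (by norm_num)
  have hτ1' : HasFDerivAt (fderiv ℝ τ) (fderiv ℝ (fderiv ℝ τ) x) x :=
    (hτ1.differentiableAt (by simp)).hasFDerivAt
  have hτd : HasFDerivAt τ (fderiv ℝ τ x) x := (hτ.differentiableAt (by simp)).hasFDerivAt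
  have hcd := ContDiffAt.eventually_hasDerivAt hc
  have hcd2 := (ContDiffAt.differentiableAt_deriv hc).hasDerivAt
  set u := deriv c t with hu
  set T := fderiv ℝ τ x with hT
  set T2 := fderiv ℝ (fderiv ℝ τ) x with hT2
  -- The velocity and the acceleration of the transformed curve.
  have hv : deriv (fun s => τ (c s)) =ᶠ[𝓝 t] fun s => fderiv ℝ τ (c s) (deriv c s) := by
    have h1 : ∀ᶠ s in 𝓝 t, ContDiffAt ℝ 2 τ (c s) :=
      hc.continuousAt.eventually (hτ.eventually (by simp))
    filter_upwards [h1, hcd] with s hs1 hs2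
    exact ((hs1.differentiableAt (by simp)).hasFDerivAt.comp_hasDerivAt s hs2).deriv
  have hv0 : deriv (fun s => τ (c s)) t = T u := hv.self_of_nhds
  have ha : deriv (deriv (fun s => τ (c s))) t = T2 u u + T (deriv (deriv c) t) := by
    rw [hv.deriv_eq]
    have h1 : HasDerivAt (fun s => fderiv ℝ τ (c s)) (T2 u) t :=
      HasFDerivAt.comp_hasDerivAt t hτ1' hcd.self_of_nhds
    exact (h1.clm_apply hcd2).deriv
  have hT2symm : ∀ a b, T2 a b = T2 b a := fun a b =>
    (hτ.isSymmSndFDerivAt (by simp)).eq a b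
  have key (a b ξ : F) : fderiv ℝ (fun y => G y a b) x ξ
      = fderiv ℝ A' (τ x) (T ξ) (T a) (T b) + A' (τ x) (T2 ξ a) (T b)
        + A' (τ x) (T a) (T2 ξ b) := by
    have h1 : (fun y => G y a b) =ᶠ[𝓝 x] fun y => A' (τ y) (fderiv ℝ τ y a) (fderiv ℝ τ y b) :=
      hG.mono fun y hy => hy a b
    rw [h1.fderiv_eq]
    have h2 : HasFDerivAt (fun y => A' (τ y)) ((fderiv ℝ A' (τ x)).comp T) x :=
      hA'.hasFDerivAt.comp x hτd
    have h3 (d : F) := hτ1'.clm_apply (hasFDerivAt_const d x)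
    have h4 := (h2.clm_apply (h3 a)).clm_apply (h3 b)
    rw [h4.fderiv]
    simp only [add_apply, ContinuousLinearMap.comp_apply,
      ContinuousLinearMap.flip_apply, zero_apply, map_zero, zero_add]
    ring
  have key' (a b ξ : F') : fderiv ℝ (fun y => G' y a b) (τ x) ξ
      = fderiv ℝ A' (τ x) ξ a b := by
    have h1 : (fun y => G' y a b) =ᶠ[𝓝 (τ x)] fun y => A' y a b := hG'.mono fun y hy => hy a b
    rw [h1.fderiv_eq]
    have h2 := (hA'.hasFDerivAt.clm_apply (hasFDerivAt_const a (τ x))).clm_apply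
      (hasFDerivAt_const b (τ x))
    rw [h2.fderiv]
    simp
  intro w'
  obtain ⟨w, rfl⟩ := hsurj w'
  have h := hgeo w
  rw [key, key, hG.self_of_nhds] at h
  rw [hv0, ha, key', key', hG'.self_of_nhds]
  have e1 := hsymm (T u) (T2 w u)
  simp only [map_add, add_apply]
  -- Symmetry of the second derivative and of the metric cancels the terms with `T2`.
  rw [hT2symm w u] at h e1
  rw [← hT] at *
  rw [e1] at h
  linarith [h]

end Transformation

/-! ### Flows near a corner -/

section Corner

variable {m : ℕ}

/-- The orthogonal projection onto the hyperplane where the `l`-th coordinate vanishes. -/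
def dropCoord (l : Fin m) : 𝔼[m] →L[ℝ] 𝔼[m] :=
  ContinuousLinearMap.id ℝ 𝔼[m]
    - (EuclideanSpace.proj l : 𝔼[m] →L[ℝ] ℝ).smulRight (EuclideanSpace.single l (1 : ℝ))

lemma dropCoord_eq (l : Fin m) (x : 𝔼[m]) :
    dropCoord l x = x - x l • EuclideanSpace.single l (1 : ℝ) := rfl

lemma dropCoord_same (l : Fin m) (x : 𝔼[m]) : dropCoord l x l = 0 := by
  simp [dropCoord_eq]

lemma dropCoord_ne {l i : Fin m} (h : i ≠ l) (x : 𝔼[m]) : dropCoord l x i = x i := by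
  simp [dropCoord_eq, h]

lemma dropCoord_eq_self {l : Fin m} {x : 𝔼[m]} (h : x l = 0) : dropCoord l x = x := by
  simp [dropCoord_eq, h]

lemma norm_sub_dropCoord (l : Fin m) (x : 𝔼[m]) : ‖x - dropCoord l x‖ = |x l| := by
  simp [dropCoord_eq, norm_smul]

lemma norm_dropCoord_le (l : Fin m) (x : 𝔼[m]) : ‖dropCoord l x‖ ≤ ‖x‖ := by
  rw [EuclideanSpace.norm_eq, EuclideanSpace.norm_eq]
  refine Real.sqrt_le_sqrt (Finset.sum_le_sum fun i _ => ?_)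
  by_cases h : i = l
  · subst h
    rw [dropCoord_same]
    simpa using sq_nonneg (x i)
  · rw [dropCoord_ne h]

lemma abs_coord_le_norm (x : 𝔼[m]) (l : Fin m) : |x l| ≤ ‖x‖ := by
  simpa using PiLp.norm_apply_le x l

lemma continuous_coord (l : Fin m) : Continuous fun x : 𝔼[m] => x l :=
  (EuclideanSpace.proj l : 𝔼[m] →L[ℝ] ℝ).continuous

lemma dropCoord_mem_ball {l : Fin m} {x₀ x : 𝔼[m]} {r : ℝ} (h : x₀ l = 0)
    (hx : x ∈ Metric.ball x₀ r) : dropCoord l x ∈ Metric.ball x₀ r := by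
  rw [Metric.mem_ball, dist_eq_norm] at hx ⊢
  refine lt_of_le_of_lt ?_ hx
  calc ‖dropCoord l x - x₀‖ = ‖dropCoord l (x - x₀)‖ := by rw [map_sub, dropCoord_eq_self h]
    _ ≤ _ := norm_dropCoord_le _ _

lemma mem_ball_prod_iff {x₀ : 𝔼[m]} {r : ℝ} {z : 𝔼[m] × 𝔼[m]} :
    z ∈ Metric.ball (x₀, (0 : 𝔼[m])) r ↔ z.1 ∈ Metric.ball x₀ r ∧ ‖z.2‖ < r := by
  rw [← ball_prod_same, mem_prod, mem_ball_zero_iff]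

/-- Moving a point of the corner along the diagonal leads to its interior. -/
lemma eventually_coord_pos {k : ℕ} {x : 𝔼[m]} (hx : x ∈ modelCorner m k) {a : ℝ} (ha : 0 < a) :
    ∀ᶠ y in 𝓝 (x + a • (WithLp.toLp 2 fun _ => (1 : ℝ) : 𝔼[m])),
      ∀ i : Fin m, i.val < k → 0 < y i := by
  refine eventually_all.2 fun i => ?_
  by_cases hi : i.val < k
  · have h1 : 0 < (x + a • (WithLp.toLp 2 fun _ => (1 : ℝ) : 𝔼[m])) i := by
      have := hx i hi
      simp only [PiLp.add_apply, PiLp.smul_apply, smul_eq_mul, mul_one]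
      linarith
    exact ((continuous_coord i).continuousAt.eventually (lt_mem_nhds h1)).mono fun y hy _ => hy
  · exact Eventually.of_forall fun y h => absurd h hi

/-- A spray flow near the point `x₀` of `[0, ∞[^k × ℝ^(m - k)` for which the faces through `x₀`
are invariant and the positions stay away from the other faces. -/
structure IsCornerFlow (k : ℕ) (S : 𝔼[m] → 𝔼[m] →L[ℝ] 𝔼[m] →L[ℝ] 𝔼[m]) (x₀ : 𝔼[m])
    (W : Set (𝔼[m] × 𝔼[m])) (U : 𝔼[m] × 𝔼[m] → C(TimeInterval, 𝔼[m] × 𝔼[m])) (r : ℝ) : Prop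
    extends IsSprayFlow S x₀ W U r where
  face : ∀ l : Fin m, l.val < k → x₀ l = 0 → ∀ z ∈ Metric.ball (x₀, (0 : 𝔼[m])) r,
    z.1 l = 0 → z.2 l = 0 → ∀ t ∈ Icc (0 : ℝ) 1, (pathExt (U z) t).1 l = 0
  away : ∀ l : Fin m, l.val < k → x₀ l ≠ 0 → ∀ z ∈ Metric.ball (x₀, (0 : 𝔼[m])) r,
    ∀ t, 0 < (pathExt (U z) t).1 l

/-- If the normal component of the spray vanishes on the vectors tangent to a face, then solutions
that start tangentially to the face stay in it: by Grönwall's inequality, the normal components of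
position and velocity vanish identically. -/
lemma IsSprayFlow.coord_eq_zero {S : 𝔼[m] → 𝔼[m] →L[ℝ] 𝔼[m] →L[ℝ] 𝔼[m]} {x₀ : 𝔼[m]}
    {W : Set (𝔼[m] × 𝔼[m])} {U : 𝔼[m] × 𝔼[m] → C(TimeInterval, 𝔼[m] × 𝔼[m])} {r R : ℝ}
    (h : IsSprayFlow S x₀ W U r) (hW : W ⊆ Metric.ball (x₀, (0 : 𝔼[m])) R) {K : NNReal}
    (hK : LipschitzOnWith K (sprayField S) (Metric.ball (x₀, (0 : 𝔼[m])) R))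
    {l : Fin m} (hl : x₀ l = 0)
    (hS : ∀ x ∈ Metric.ball x₀ R, ∀ v,
      S (dropCoord l x) (dropCoord l v) (dropCoord l v) l = 0)
    {z : 𝔼[m] × 𝔼[m]} (hz : z ∈ Metric.ball (x₀, (0 : 𝔼[m])) r) (h1 : z.1 l = 0) (h2 : z.2 l = 0)
    {t : ℝ} (ht : t ∈ Icc (0 : ℝ) 1) : (pathExt (U z) t).1 l = 0 := by
  let P : 𝔼[m] × 𝔼[m] →L[ℝ] 𝔼[m] × 𝔼[m] := (dropCoord l).prodMap (dropCoord l)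
  let Q : 𝔼[m] × 𝔼[m] →L[ℝ] 𝔼[m] × 𝔼[m] := ContinuousLinearMap.id ℝ _ - P
  have hQ (w : 𝔼[m] × 𝔼[m]) : Q w = w - P w := rfl
  have hQ0 {w : 𝔼[m] × 𝔼[m]} (h1 : w.1 l = 0) (h2 : w.2 l = 0) : Q w = 0 := by
    rw [hQ, sub_eq_zero]
    exact Prod.ext (dropCoord_eq_self h1).symm (dropCoord_eq_self h2).symm
  have hPW {w : 𝔼[m] × 𝔼[m]} (hw : w ∈ Metric.ball (x₀, (0 : 𝔼[m])) R) :
      P w ∈ Metric.ball (x₀, (0 : 𝔼[m])) R := by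
    rw [mem_ball_prod_iff] at hw ⊢
    exact ⟨dropCoord_mem_ball hl hw.1, (norm_dropCoord_le _ _).trans_lt hw.2⟩
  have hspray {w : 𝔼[m] × 𝔼[m]} (hw : w ∈ Metric.ball (x₀, (0 : 𝔼[m])) R) :
      Q (sprayField S (P w)) = 0 :=
    hQ0 (dropCoord_same _ _) (hS w.1 (mem_ball_prod_iff.1 hw).1 w.2)
  have hder (s : ℝ) (hs : s ∈ Icc (0 : ℝ) 1) := h.hasDerivAt z hz s
    ⟨by linarith [hs.1], by linarith [hs.2]⟩
  have key := eq_zero_of_abs_deriv_le_mul_abs_self_of_eq_zero_right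
    (f := fun s => Q (pathExt (U z) s)) (f' := fun s => Q (sprayField S (pathExt (U z) s)))
    (K := ‖Q‖ * K) (a := 0) (b := 1) (by fun_prop)
    (fun s hs => (Q.hasFDerivAt.comp_hasDerivAt s
      (hder s (Ico_subset_Icc_self hs))).hasDerivWithinAt)
    (by rw [h.init z hz]; exact hQ0 h1 h2)
    (fun s hs => by
      have hw := hW (h.mem z hz s)
      calc ‖Q (sprayField S (pathExt (U z) s))‖
          = ‖Q (sprayField S (pathExt (U z) s) - sprayField S (P (pathExt (U z) s)))‖ := by
            rw [map_sub, hspray hw, sub_zero]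
        _ ≤ ‖Q‖ * ‖sprayField S (pathExt (U z) s) - sprayField S (P (pathExt (U z) s))‖ :=
            Q.le_opNorm _
        _ ≤ ‖Q‖ * (K * ‖pathExt (U z) s - P (pathExt (U z) s)‖) := by
            gcongr
            simpa [dist_eq_norm] using hK.dist_le_mul _ hw _ (hPW hw)
        _ = ‖Q‖ * K * ‖Q (pathExt (U z) s)‖ := by rw [hQ, mul_assoc]) t ht
  have h3 : (Q (pathExt (U z) t)).1 l = 0 := by
    have : Q (pathExt (U z) t) = 0 := key
    rw [this]; rfl
  have h4 : (Q (pathExt (U z) t)).1 l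
      = (pathExt (U z) t).1 l - dropCoord l (pathExt (U z) t).1 l := rfl
  rw [h4, dropCoord_same, sub_zero] at h3
  exact h3

/-- A spray that is tangent to the hyperplanes of the faces through `x₀` has a corner flow. -/
theorem exists_isCornerFlow {k : ℕ} {S : 𝔼[m] → 𝔼[m] →L[ℝ] 𝔼[m] →L[ℝ] 𝔼[m]} {x₀ : 𝔼[m]}
    (hx₀ : x₀ ∈ modelCorner m k) (hS : ContDiffAt ℝ ω S x₀)
    (hface : ∀ l : Fin m, l.val < k → x₀ l = 0 → ∀ᶠ x in 𝓝 x₀, ∀ v,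
      S (dropCoord l x) (dropCoord l v) (dropCoord l v) l = 0)
    {W : Set (𝔼[m] × 𝔼[m])} (hW : W ∈ 𝓝 (x₀, (0 : 𝔼[m]))) :
    ∃ U r, IsCornerFlow k S x₀ W U r := by
  have h1 : ∀ᶠ x in 𝓝 x₀, ∀ l : Fin m, l.val < k → x₀ l = 0 → ∀ v,
      S (dropCoord l x) (dropCoord l v) (dropCoord l v) l = 0 := by
    rw [eventually_all]
    intro l
    by_cases hl : l.val < k ∧ x₀ l = 0
    · exact (hface l hl.1 hl.2).mono fun x hx _ _ => hx
    · exact Eventually.of_forall fun x h1 h2 => absurd ⟨h1, h2⟩ hl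
  have h2 : ∀ᶠ x in 𝓝 x₀, ∀ l : Fin m, l.val < k → x₀ l ≠ 0 → 0 < x l := by
    rw [eventually_all]
    intro l
    by_cases hl : l.val < k ∧ x₀ l ≠ 0
    · have : 0 < x₀ l := lt_of_le_of_ne (hx₀ l hl.1) (Ne.symm hl.2)
      exact ((continuous_coord l).continuousAt.eventually (lt_mem_nhds this)).mono
        fun x hx _ _ => hx
    · exact Eventually.of_forall fun x h1 h2 => absurd ⟨h1, h2⟩ hl
  have h3 : ContDiffAt ℝ 1 (sprayField S) (x₀, (0 : 𝔼[m])) :=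
    (contDiffAt_sprayField (z := (x₀, (0 : 𝔼[m]))) hS).of_le le_top
  obtain ⟨K, s, hs, hK⟩ := h3.exists_lipschitzOnWith
  have h4 : ∀ᶠ z in 𝓝 (x₀, (0 : 𝔼[m])), z ∈ s := hs
  have h5 : ∀ᶠ z in 𝓝 (x₀, (0 : 𝔼[m])), z ∈ W := hW
  have hfst : Tendsto Prod.fst (𝓝 (x₀, (0 : 𝔼[m]))) (𝓝 x₀) := continuousAt_fst
  obtain ⟨R, hR, hb⟩ := Metric.eventually_nhds_iff_ball.1
    ((hfst.eventually (h1.and h2)).and (h4.and h5))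
  obtain ⟨U, r, hU⟩ := exists_isSprayFlow hS (Metric.ball_mem_nhds (x₀, (0 : 𝔼[m])) hR)
  refine ⟨U, r, ⟨⟨hU.pos, hU.contDiffAt, hU.base, hU.init, hU.hasDerivAt, fun z hz t => ?_,
    hU.lip⟩, fun l hlk hl z hz hz1 hz2 t ht => ?_, fun l hlk hl z hz t => ?_⟩⟩
  · exact (hb _ (hU.mem z hz t)).2.2
  · refine hU.coord_eq_zero subset_rfl (hK.mono fun z hz => (hb z hz).2.1) hl
      (fun x hx v => ?_) hz hz1 hz2 ht
    exact (hb (x, 0) (mem_ball_prod_iff.2 ⟨hx, by simpa using hR⟩)).1.1 l hlk hl v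
  · exact (hb _ (hU.mem z hz t)).1.2 l hlk hl

lemma IsCornerFlow.mono {k : ℕ} {S : 𝔼[m] → 𝔼[m] →L[ℝ] 𝔼[m] →L[ℝ] 𝔼[m]} {x₀ : 𝔼[m]}
    {W : Set (𝔼[m] × 𝔼[m])} {U : 𝔼[m] × 𝔼[m] → C(TimeInterval, 𝔼[m] × 𝔼[m])} {r r' : ℝ}
    (h : IsCornerFlow k S x₀ W U r) (h0 : 0 < r') (hr : r' ≤ r) : IsCornerFlow k S x₀ W U r' := by
  have hs := Metric.ball_subset_ball (x := (x₀, (0 : 𝔼[m]))) hr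
  exact ⟨h.toIsSprayFlow.mono h0 hr, fun l hl hl0 z hz => h.face l hl hl0 z (hs hz),
    fun l hl hl0 z hz => h.away l hl hl0 z (hs hz)⟩

/-- On the points of `[0, ∞[^k × ℝ^(m - k)` near `x₀`, the vector field `ξ` is bounded and
Lipschitz with the constant `ε`, and its normal components are at most `ε` times the distance to
the face. -/
structure IsSmallField (k : ℕ) (x₀ : 𝔼[m]) (r ε : ℝ) (ξ : 𝔼[m] → 𝔼[m]) : Prop where
  norm_le : ∀ x ∈ Metric.ball x₀ r ∩ modelCorner m k, ‖ξ x‖ ≤ ε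
  lip : ∀ x ∈ Metric.ball x₀ r ∩ modelCorner m k, ∀ x' ∈ Metric.ball x₀ r ∩ modelCorner m k,
    ‖ξ x - ξ x'‖ ≤ ε * ‖x - x'‖
  normal_le : ∀ x ∈ Metric.ball x₀ r ∩ modelCorner m k, ∀ l : Fin m, l.val < k →
    |ξ x l| ≤ ε * x l

variable {k : ℕ} {S : 𝔼[m] → 𝔼[m] →L[ℝ] 𝔼[m] →L[ℝ] 𝔼[m]} {x₀ : 𝔼[m]} {W : Set (𝔼[m] × 𝔼[m])}
  {r ε : ℝ} {ξ : 𝔼[m] → 𝔼[m]} {U : 𝔼[m] × 𝔼[m] → C(TimeInterval, 𝔼[m] × 𝔼[m])}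

lemma IsSmallField.mem_ball (hξ : IsSmallField k x₀ r ε ξ) (hε : ε < r) {x : 𝔼[m]}
    (hx : x ∈ Metric.ball x₀ r ∩ modelCorner m k) : (x, ξ x) ∈ Metric.ball (x₀, (0 : 𝔼[m])) r :=
  mem_ball_prod_iff.2 ⟨hx.1, (hξ.norm_le x hx).trans_lt hε⟩

/-- Along the flow of a small field, the distance `x l` to a face through `x₀` changes by at most
half of itself. The comparison is with the solution that starts at the projection of the initial
value to the face: it stays in the face, and the distance of the initial values is at most `x l`. -/
lemma IsCornerFlow.abs_coord_sub_le (h : IsCornerFlow k S x₀ W U r)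
    (hξ : IsSmallField k x₀ r ε ξ) (hε : ε < r) (hε4 : ε ≤ 1 / 4) {x : 𝔼[m]}
    (hx : x ∈ Metric.ball x₀ r ∩ modelCorner m k) {l : Fin m}
    (hl : l.val < k) (hl0 : x₀ l = 0) {t : ℝ} (ht : t ∈ Icc (0 : ℝ) 1) :
    |(pathExt (U (x, ξ x)) t).1 l - x l| ≤ 1 / 2 * x l := by
  have hz := IsSmallField.mem_ball hξ hε hx
  have hxl : 0 ≤ x l := hx.2 l hl
  have hz' : (dropCoord l x, dropCoord l (ξ x)) ∈ Metric.ball (x₀, (0 : 𝔼[m])) r := by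
    rw [mem_ball_prod_iff] at hz ⊢
    exact ⟨dropCoord_mem_ball hl0 hz.1, (norm_dropCoord_le _ _).trans_lt hz.2⟩
  have h0 := h.face l hl hl0 _ hz' (dropCoord_same _ _) (dropCoord_same _ _) t ht
  have h1 := (abs_coord_le_norm _ l).trans (h.lip _ hz _ hz' t ht)
  have h2 := hξ.normal_le x hx l hl
  have h3 : ‖(x, ξ x) - (dropCoord l x, dropCoord l (ξ x))‖ ≤ x l := by
    rw [Prod.mk_sub_mk, Prod.norm_mk, norm_sub_dropCoord, norm_sub_dropCoord]
    refine max_le (abs_of_nonneg hxl).le (h2.trans ?_)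
    nlinarith
  simp only [PiLp.sub_apply, PiLp.smul_apply, h0, dropCoord_same, sub_zero, smul_eq_mul] at h1
  have h4 : |t * ξ x l| ≤ 1 / 4 * x l := by
    rw [abs_mul, abs_of_nonneg ht.1]
    have : |ξ x l| ≤ 1 / 4 * x l := h2.trans (by gcongr)
    nlinarith [ht.2, abs_nonneg (ξ x l)]
  rw [abs_le] at h1 h4 ⊢
  constructor <;> linarith [h1.1, h1.2, h4.1, h4.2]

/-- The flow of a small field preserves `[0, ∞[^k × ℝ^(m - k)` and its stratification. -/
lemma IsCornerFlow.coord_nonneg_and_eq_zero_iff (h : IsCornerFlow k S x₀ W U r)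
    (hξ : IsSmallField k x₀ r ε ξ) (hε : ε < r)
    (hε4 : ε ≤ 1 / 4) {x : 𝔼[m]}
    (hx : x ∈ Metric.ball x₀ r ∩ modelCorner m k) {l : Fin m}
    (hl : l.val < k) {t : ℝ} (ht : t ∈ Icc (0 : ℝ) 1) :
    0 ≤ (pathExt (U (x, ξ x)) t).1 l ∧ ((pathExt (U (x, ξ x)) t).1 l = 0 ↔ x l = 0) := by
  have hz := IsSmallField.mem_ball hξ hε hx
  have hxl : 0 ≤ x l := hx.2 l hl
  by_cases hl0 : x₀ l = 0
  · have h1 := abs_le.1 (h.abs_coord_sub_le hξ hε hε4 hx hl hl0 ht)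
    refine ⟨by linarith [h1.1], fun h2 => by linarith [h1.1], fun h2 => ?_⟩
    rw [h2] at h1
    linarith [h1.1, h1.2]
  · have h1 := h.away l hl hl0 _ hz t
    have h2 := h.away l hl hl0 _ hz 0
    rw [h.init _ hz] at h2
    exact ⟨h1.le, fun h3 => absurd h3 h1.ne', fun h3 => absurd h3 h2.ne'⟩

lemma IsCornerFlow.mem_modelCorner (h : IsCornerFlow k S x₀ W U r)
    (hξ : IsSmallField k x₀ r ε ξ) (hε : ε < r) (hε4 : ε ≤ 1 / 4) {x : 𝔼[m]}
    (hx : x ∈ Metric.ball x₀ r ∩ modelCorner m k) {t : ℝ}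
    (ht : t ∈ Icc (0 : ℝ) 1) : (pathExt (U (x, ξ x)) t).1 ∈ modelCorner m k :=
  fun _ hl => (h.coord_nonneg_and_eq_zero_iff hξ hε hε4 hx hl ht).1

lemma IsCornerFlow.cornerIndex_eq (h : IsCornerFlow k S x₀ W U r)
    (hξ : IsSmallField k x₀ r ε ξ) (hε : ε < r) (hε4 : ε ≤ 1 / 4) {x : 𝔼[m]}
    (hx : x ∈ Metric.ball x₀ r ∩ modelCorner m k) {t : ℝ}
    (ht : t ∈ Icc (0 : ℝ) 1) :
    cornerIndex k (pathExt (U (x, ξ x)) t).1 = cornerIndex k x := by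
  unfold cornerIndex
  congr 1
  ext l
  simp only [mem_ofPred_eq]
  exact and_congr_right fun hl => (h.coord_nonneg_and_eq_zero_iff hξ hε hε4 hx hl ht).2

/-- The time one map of a small field differs from the identity by a contraction. -/
lemma IsCornerFlow.norm_sub_sub_le (h : IsCornerFlow k S x₀ W U r)
    (hξ : IsSmallField k x₀ r ε ξ) (hε : ε < r) (hε4 : ε ≤ 1 / 4) {x x' : 𝔼[m]}
    (hx : x ∈ Metric.ball x₀ r ∩ modelCorner m k)
    (hx' : x' ∈ Metric.ball x₀ r ∩ modelCorner m k) :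
    ‖(pathExt (U (x, ξ x)) 1).1 - (pathExt (U (x', ξ x')) 1).1 - (x - x')‖
      ≤ 1 / 2 * ‖x - x'‖ := by
  have h1 := h.lip _ (IsSmallField.mem_ball hξ hε hx) _ (IsSmallField.mem_ball hξ hε hx') 1
    (by norm_num)
  have h2 : ‖ξ x - ξ x'‖ ≤ 1 / 4 * ‖x - x'‖ := (hξ.lip x hx x' hx').trans (by gcongr)
  have h3 : ‖(x, ξ x) - (x', ξ x')‖ ≤ ‖x - x'‖ := by
    rw [Prod.mk_sub_mk, Prod.norm_mk]
    exact max_le le_rfl (by linarith [norm_nonneg (x - x')])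
  simp only [one_smul] at h1
  calc _ = ‖((pathExt (U (x, ξ x)) 1).1 - (pathExt (U (x', ξ x')) 1).1 - (x - x')
        - (ξ x - ξ x')) + (ξ x - ξ x')‖ := by congr 1; abel
    _ ≤ _ := norm_add_le _ _
    _ ≤ _ := by linarith

lemma IsCornerFlow.injOn (h : IsCornerFlow k S x₀ W U r)
    (hξ : IsSmallField k x₀ r ε ξ) (hε : ε < r) (hε4 : ε ≤ 1 / 4) :
    InjOn (fun x => (pathExt (U (x, ξ x)) 1).1) (Metric.ball x₀ r ∩ modelCorner m k) := by
  intro x hx x' hx' heq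
  have h1 := h.norm_sub_sub_le hξ hε hε4 hx hx'
  simp only at heq
  rw [heq, sub_self, zero_sub, norm_neg] at h1
  have h2 : ‖x - x'‖ = 0 := by linarith [norm_nonneg (x - x')]
  exact sub_eq_zero.1 (norm_eq_zero.1 h2)

/-- The time one map of a small field is locally surjective: a preimage of `y` is a fixed point
of the contraction `x ↦ y - (f x - x)`, which preserves the box where `0 ≤ x l ≤ 2 y l` for the
faces through `x₀`. -/
lemma IsCornerFlow.exists_preimage (h : IsCornerFlow k S x₀ W U r) (hξ : IsSmallField k x₀ r ε ξ)
    (hε : ε ≤ r / 8) (hε4 : ε ≤ 1 / 4) {y : 𝔼[m]}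
    (hy : y ∈ Metric.ball x₀ (r / 8) ∩ modelCorner m k) :
    ∃ x ∈ Metric.ball x₀ r ∩ modelCorner m k, (pathExt (U (x, ξ x)) 1).1 = y := by
  have hr := h.pos
  have hεr : ε < r := by linarith
  let f : 𝔼[m] → 𝔼[m] := fun x => (pathExt (U (x, ξ x)) 1).1
  let T : 𝔼[m] → 𝔼[m] := fun x => y - (f x - x)
  let B : Set 𝔼[m] := Metric.closedBall x₀ (r / 2) ∩
    ⋂ l : Fin m, {x | l.val < k → x₀ l = 0 → 0 ≤ x l ∧ x l ≤ 2 * y l}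
  have hB : B ⊆ Metric.ball x₀ r ∩ modelCorner m k := by
    intro x hx
    have hxr : x ∈ Metric.ball x₀ r := Metric.closedBall_subset_ball (by linarith) hx.1
    refine ⟨hxr, fun l hl => ?_⟩
    by_cases hl0 : x₀ l = 0
    · exact (mem_iInter.1 hx.2 l hl hl0).1
    · have hz : (x, (0 : 𝔼[m])) ∈ Metric.ball (x₀, (0 : 𝔼[m])) r :=
        mem_ball_prod_iff.2 ⟨hxr, by simpa using hr⟩
      have := h.away l hl hl0 _ hz 0
      rw [h.init _ hz] at this
      exact this.le
  have hBclosed : IsClosed B := by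
    refine Metric.isClosed_closedBall.inter (isClosed_iInter fun l => ?_)
    by_cases hl : l.val < k ∧ x₀ l = 0
    · have : {x : 𝔼[m] | l.val < k → x₀ l = 0 → 0 ≤ x l ∧ x l ≤ 2 * y l}
          = {x : 𝔼[m] | 0 ≤ x l} ∩ {x : 𝔼[m] | x l ≤ 2 * y l} := by
        ext x; simp [hl.1, hl.2]
      rw [this]
      exact (isClosed_le continuous_const (continuous_coord l)).inter
        (isClosed_le (continuous_coord l) continuous_const)
    · have : {x : 𝔼[m] | l.val < k → x₀ l = 0 → 0 ≤ x l ∧ x l ≤ 2 * y l} = univ := by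
        ext x
        simp only [mem_ofPred_eq, mem_univ, iff_true]
        exact fun h1 h2 => absurd ⟨h1, h2⟩ hl
      rw [this]
      exact isClosed_univ
  have hx₀r : (x₀, (0 : 𝔼[m])) ∈ Metric.ball (x₀, (0 : 𝔼[m])) r := Metric.mem_ball_self hr
  have hy1 := hy.1
  rw [Metric.mem_ball, dist_eq_norm] at hy1
  have hT : MapsTo T B B := by
    intro x hx
    have hx' := hB hx
    refine ⟨?_, mem_iInter.2 fun l hl hl0 => ?_⟩
    · have h1 := h.lip _ (IsSmallField.mem_ball hξ hεr hx') _ hx₀r 1 (by norm_num)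
      rw [h.base] at h1
      have h2 := hξ.norm_le x hx'
      have hx2 := hx.1
      rw [Metric.mem_closedBall, dist_eq_norm] at hx2
      have h3 : ‖(x, ξ x) - (x₀, 0)‖ ≤ r / 2 := by
        rw [Prod.mk_sub_mk, Prod.norm_mk, sub_zero]
        exact max_le hx2 (by linarith)
      rw [Metric.mem_closedBall, dist_eq_norm]
      simp only [one_smul, sub_zero] at h1
      calc ‖T x - x₀‖ = ‖(y - x₀) - (f x - x₀ - (x - x₀) - ξ x) - ξ x‖ := by
            congr 1; simp only [T]; abel
        _ ≤ ‖(y - x₀) - (f x - x₀ - (x - x₀) - ξ x)‖ + ‖ξ x‖ := norm_sub_le _ _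
        _ ≤ ‖y - x₀‖ + ‖f x - x₀ - (x - x₀) - ξ x‖ + ‖ξ x‖ := by gcongr; exact norm_sub_le _ _
        _ ≤ r / 2 := by linarith
    · have h1 := abs_le.1 (h.abs_coord_sub_le hξ hεr hε4 hx' hl hl0 (t := 1) (by norm_num))
      have h2 := mem_iInter.1 hx.2 l hl hl0
      have h3 : T x l = y l - (f x l - x l) := rfl
      rw [h3]
      constructor <;> linarith [h1.1, h1.2, h2.1, h2.2]
  have hcontr : ContractingWith (1 / 2) (hT.restrict T B B) := by
    refine ⟨by norm_num, LipschitzWith.of_dist_le_mul fun x x' => ?_⟩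
    rw [Subtype.dist_eq, Subtype.dist_eq, dist_eq_norm, dist_eq_norm]
    have h1 := h.norm_sub_sub_le hξ hεr hε4 (hB x.2) (hB x'.2)
    have h2 : T x - T x' = -(f x - f x' - (x - x')) := by simp only [T]; abel
    change ‖T x - T x'‖ ≤ _
    rw [h2, norm_neg]
    simpa using h1
  have hyB : y ∈ B := by
    refine ⟨?_, mem_iInter.2 fun l hl hl0 => ?_⟩
    · rw [Metric.mem_closedBall, dist_eq_norm]
      linarith
    · have := hy.2 l hl
      constructor <;> linarith
  obtain ⟨x, hxB, hfix, -⟩ := hcontr.exists_fixedPoint' hBclosed.isComplete hT hyB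
    (edist_ne_top _ _)
  refine ⟨x, hB hxB, ?_⟩
  have h1 : y - (f x - x) = x := hfix
  have h2 : y - f x = 0 := by
    have : y - f x = (y - (f x - x)) - x := by abel
    rw [this, h1, sub_self]
  exact (sub_eq_zero.1 h2).symm

end Corner

variable {m : ℕ} {X : Type*} [TopologicalSpace X] [ChartedSpace 𝔼[m] X]

/-! ### The metric, its spray and its geodesics in charts -/

section Charts

variable [IsManifold (𝓡 m) ω X]

/-- The metric that `g` induces on the range of the chart `φ`, as a continuous bilinear form. -/
def chartForm (g : AnalyticMetric m X) (φ : OpenPartialHomeomorph X 𝔼[m]) (x : 𝔼[m]) :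
    𝔼[m] →L[ℝ] 𝔼[m] →L[ℝ] ℝ :=
  ContinuousLinearMap.bilinearComp (E := 𝔼[m]) (F := 𝔼[m]) (g.inner (φ.symm x))
    (mfderiv (𝓡 m) (𝓡 m) φ.symm x) (mfderiv (𝓡 m) (𝓡 m) φ.symm x)

lemma chartForm_apply (g : AnalyticMetric m X) (φ : OpenPartialHomeomorph X 𝔼[m])
    (x u v : 𝔼[m]) : chartForm g φ x u v = chartMetric g φ x u v := rfl

lemma contMDiffOn_pushforward {φ : OpenPartialHomeomorph X 𝔼[m]}
    (hφ : φ ∈ IsManifold.maximalAtlas (𝓡 m) ω X) (u : 𝔼[m]) :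
    ContMDiffOn (𝓡 m) (𝓡 m).tangent ω
      (fun x => (⟨φ.symm x, mfderiv (𝓡 m) (𝓡 m) φ.symm x u⟩ : TangentBundle (𝓡 m) X))
      φ.target := by
  have h1 := (contMDiffOn_symm_of_mem_maximalAtlas hφ).contMDiffOn_tangentMapWithin
    (m := ω) (by simp) φ.open_target.uniqueMDiffOn
  have h2 : ContMDiff (𝓡 m) (𝓡 m).tangent ω
      (fun x : 𝔼[m] => (⟨x, u⟩ : TangentBundle (𝓡 m) 𝔼[m])) := by
    intro x
    exact contMDiffAt_vectorSpace_iff_contDiffAt.2 contDiffAt_const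
  refine (h1.comp h2.contMDiffOn fun x hx => hx).congr fun x hx => ?_
  simp only [Function.comp_apply, tangentMapWithin,
    mfderivWithin_of_isOpen φ.open_target hx]

lemma contDiffOn_chartForm (g : AnalyticMetric m X) {φ : OpenPartialHomeomorph X 𝔼[m]}
    (hφ : φ ∈ IsManifold.maximalAtlas (𝓡 m) ω X) : ContDiffOn ℝ ω (chartForm g φ) φ.target := by
  rw [contDiffOn_clm_apply]
  intro u
  rw [contDiffOn_clm_apply]
  intro v
  rw [← contMDiffOn_iff_contDiffOn]
  intro x hx
  have h1 := (g.contMDiff.contMDiffAt (x := φ.symm x)).comp_contMDiffWithinAt x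
    (contMDiffOn_symm_of_mem_maximalAtlas hφ x hx)
  have h2 := ContMDiffWithinAt.clm_bundle_apply₂ (F₁ := 𝔼[m]) (F₂ := 𝔼[m]) (F₃ := ℝ)
    (E₃ := fun _ : X => ℝ) h1
    (contMDiffOn_pushforward hφ u x hx) (contMDiffOn_pushforward hφ v x hx)
  exact (Bundle.contMDiffWithinAt_totalSpace.1 h2).2

variable {g : AnalyticMetric m X} {φ ψ : OpenPartialHomeomorph X 𝔼[m]}

omit [IsManifold (𝓡 m) ω X] in
lemma chart_mdifferentiable (hφ : φ ∈ IsManifold.maximalAtlas (𝓡 m) ω X) :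
    φ.MDifferentiable (𝓡 m) (𝓡 m) :=
  ⟨(contMDiffOn_of_mem_maximalAtlas hφ).mdifferentiableOn (by simp),
    (contMDiffOn_symm_of_mem_maximalAtlas hφ).mdifferentiableOn (by simp)⟩

lemma chartForm_symm (x u v : 𝔼[m]) : chartForm g φ x u v = chartForm g φ x v u :=
  g.symm _ _ _

lemma chartForm_pos (hφ : φ ∈ IsManifold.maximalAtlas (𝓡 m) ω X) {x : 𝔼[m]} (hx : x ∈ φ.target)
    (v : 𝔼[m]) (hv : v ≠ 0) : 0 < chartForm g φ x v v := by
  refine g.pos _ _ fun h => hv ?_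
  have h1 := DFunLike.congr_fun ((chart_mdifferentiable hφ).comp_symm_deriv hx) v
  have h2 : mfderiv (𝓡 m) (𝓡 m) φ (φ.symm x) (mfderiv (𝓡 m) (𝓡 m) φ.symm x v) = v := h1
  exact h2.symm.trans ((congrArg (mfderiv (𝓡 m) (𝓡 m) φ (φ.symm x)) h).trans (map_zero _))

lemma contDiffAt_chartForm (hφ : φ ∈ IsManifold.maximalAtlas (𝓡 m) ω X) {x : 𝔼[m]}
    (hx : x ∈ φ.target) : ContDiffAt ℝ ω (chartForm g φ) x :=
  (contDiffOn_chartForm g hφ).contDiffAt (φ.open_target.mem_nhds hx)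

/-- The geodesic spray of `g` in the chart `φ`. -/
def chartSpray (g : AnalyticMetric m X) (φ : OpenPartialHomeomorph X 𝔼[m]) :
    𝔼[m] → 𝔼[m] →L[ℝ] 𝔼[m] →L[ℝ] 𝔼[m] :=
  metricSpray (chartForm g φ)

lemma contDiffAt_chartSpray (hφ : φ ∈ IsManifold.maximalAtlas (𝓡 m) ω X) {x : 𝔼[m]}
    (hx : x ∈ φ.target) : ContDiffAt ℝ ω (chartSpray g φ) x :=
  contDiffAt_metricSpray (contDiffAt_chartForm hφ hx) (chartForm_pos hφ hx)

lemma geodesicEq_chartMetric_iff (hφ : φ ∈ IsManifold.maximalAtlas (𝓡 m) ω X) {c : ℝ → 𝔼[m]}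
    {t : ℝ} (hc : c t ∈ φ.target) :
    GeodesicEq (chartMetric g φ) c t ↔
      deriv (deriv c) t = chartSpray g φ (c t) (deriv c t) (deriv c t) :=
  geodesicEq_iff (A := chartForm g φ) (Eventually.of_forall fun _ _ _ => rfl)
    ((contDiffAt_chartForm hφ hc).differentiableAt (by simp)) (chartForm_pos hφ hc)

omit [IsManifold (𝓡 m) ω X] in
lemma contDiffAt_transition (hφ : φ ∈ IsManifold.maximalAtlas (𝓡 m) ω X)
    (hψ : ψ ∈ IsManifold.maximalAtlas (𝓡 m) ω X) {x : 𝔼[m]} (hx : x ∈ φ.target)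
    (hx' : φ.symm x ∈ ψ.source) : ContDiffAt ℝ ω (fun y => ψ (φ.symm y)) x := by
  rw [← contMDiffAt_iff_contDiffAt]
  exact (contMDiffAt_of_mem_maximalAtlas hψ hx').comp x
    (contMDiffAt_symm_of_mem_maximalAtlas hφ hx)

omit [IsManifold (𝓡 m) ω X] in
lemma fderiv_transition_comp (hφ : φ ∈ IsManifold.maximalAtlas (𝓡 m) ω X)
    (hψ : ψ ∈ IsManifold.maximalAtlas (𝓡 m) ω X) {x : 𝔼[m]} (hx : x ∈ φ.target)
    (hx' : φ.symm x ∈ ψ.source) (v : 𝔼[m]) :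
    fderiv ℝ (fun y => ψ (φ.symm y)) x (fderiv ℝ (fun y => φ (ψ.symm y)) (ψ (φ.symm x)) v) = v := by
  have hy : ψ (φ.symm x) ∈ ψ.target := ψ.map_source hx'
  have hback : ψ.symm (ψ (φ.symm x)) = φ.symm x := ψ.left_inv hx'
  have hy' : ψ.symm (ψ (φ.symm x)) ∈ φ.source := by rw [hback]; exact φ.map_target hx
  have h1 := ((contDiffAt_transition hφ hψ hx hx').differentiableAt (by simp)).hasFDerivAt
  have h2 := ((contDiffAt_transition hψ hφ hy hy').differentiableAt (by simp)).hasFDerivAt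
  have hx2 : φ (ψ.symm (ψ (φ.symm x))) = x := by rw [hback, φ.right_inv hx]
  have h3 : HasFDerivAt (fun y => ψ (φ.symm (φ (ψ.symm y)))) _ (ψ (φ.symm x)) :=
    HasFDerivAt.comp (ψ (φ.symm x)) (g := fun y => ψ (φ.symm y)) (by rw [hx2]; exact h1) h2
  have h4 : (fun y => ψ (φ.symm (φ (ψ.symm y)))) =ᶠ[𝓝 (ψ (φ.symm x))] id := by
    have hc : ContinuousAt ψ.symm (ψ (φ.symm x)) := ψ.continuousAt_symm hy
    filter_upwards [ψ.open_target.mem_nhds hy, hc (φ.open_source.mem_nhds hy')] with y hy1 hy2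
    rw [φ.left_inv hy2, ψ.right_inv hy1, id]
  have h5 := h3.unique ((hasFDerivAt_id _).congr_of_eventuallyEq h4)
  exact DFunLike.congr_fun h5 v

lemma chartMetric_transition (hφ : φ ∈ IsManifold.maximalAtlas (𝓡 m) ω X)
    (hψ : ψ ∈ IsManifold.maximalAtlas (𝓡 m) ω X) {x : 𝔼[m]} (hx : x ∈ φ.target)
    (hx' : φ.symm x ∈ ψ.source) (u v : 𝔼[m]) :
    chartMetric g φ x u v = chartForm g ψ (ψ (φ.symm x))
      (fderiv ℝ (fun y => ψ (φ.symm y)) x u) (fderiv ℝ (fun y => ψ (φ.symm y)) x v) := by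
  have hy : ψ (φ.symm x) ∈ ψ.target := ψ.map_source hx'
  have hback : ψ.symm (ψ (φ.symm x)) = φ.symm x := ψ.left_inv hx'
  have h1 : HasMFDerivAt (𝓡 m) (𝓡 m) (fun y => ψ (φ.symm y)) x
      (fderiv ℝ (fun y => ψ (φ.symm y)) x) :=
    ((contDiffAt_transition hφ hψ hx hx').differentiableAt (by simp)).hasFDerivAt.hasMFDerivAt
  have h2 := ((chart_mdifferentiable hψ).mdifferentiableAt_symm hy).hasMFDerivAt
  have h3 := HasMFDerivAt.comp x h2 h1
  have h4 : φ.symm =ᶠ[𝓝 x] ψ.symm ∘ (fun y => ψ (φ.symm y)) := by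
    have hc : ContinuousAt φ.symm x := φ.continuousAt_symm hx
    filter_upwards [hc (ψ.open_source.mem_nhds hx')] with y hy2
    exact (ψ.left_inv hy2).symm
  have h5 := (h3.congr_of_eventuallyEq h4).mfderiv
  rw [chartForm_apply]
  unfold chartMetric
  rw [h5]
  have key : ∀ p q : X, p = q → ∀ a b : 𝔼[m], g.inner p a b = g.inner q a b := by
    rintro p _ rfl a b; rfl
  exact key _ _ hback.symm _ _

/-- A curve that satisfies the geodesic equation in one chart satisfies it in all charts. -/
lemma isGeodesicAt_symm_comp (hφ : φ ∈ IsManifold.maximalAtlas (𝓡 m) ω X) {c : ℝ → 𝔼[m]} {t : ℝ}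
    (hc : ContDiffAt ℝ 2 c t) (hct : c t ∈ φ.target) (hgeo : GeodesicEq (chartMetric g φ) c t) :
    IsGeodesicAt g (fun s => φ.symm (c s)) t := by
  refine ⟨?_, fun ψ hψ hψt => ?_⟩
  · exact ((contMDiffAt_symm_of_mem_maximalAtlas hφ hct).of_le le_top).comp t hc.contMDiffAt
  · have hτ := contDiffAt_transition hφ hψ hct hψt
    have hy : ψ (φ.symm (c t)) ∈ ψ.target := ψ.map_source hψt
    refine GeodesicEq.comp (A' := chartForm g ψ) (τ := fun y => ψ (φ.symm y)) hgeo hc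
      (hτ.of_le le_top) (fun v => ⟨_, fderiv_transition_comp hφ hψ hct hψt v⟩)
      ((contDiffAt_chartForm hψ hy).differentiableAt (by simp)) (fun u v => chartForm_symm _ _ _)
      (Eventually.of_forall fun _ _ _ => rfl) ?_
    have hcont : ContinuousAt φ.symm (c t) := φ.continuousAt_symm hct
    filter_upwards [φ.open_target.mem_nhds hct, hcont (ψ.open_source.mem_nhds hψt)]
      with y hy1 hy2 u v
    exact chartMetric_transition hφ hψ hy1 hy2 u v

end Charts

/-! ### Uniqueness of geodesics -/

section Uniqueness

variable [IsManifold (𝓡 m) ω X] {g : AnalyticMetric m X} {φ : OpenPartialHomeomorph X 𝔼[m]}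

lemma IsGeodesicAt.contDiffAt {γ : ℝ → X} {t : ℝ} (h : IsGeodesicAt g γ t)
    (hφ : φ ∈ IsManifold.maximalAtlas (𝓡 m) ω X) (ht : γ t ∈ φ.source) :
    ContDiffAt ℝ 2 (fun s => φ (γ s)) t := by
  rw [← contMDiffAt_iff_contDiffAt]
  exact ((contMDiffAt_of_mem_maximalAtlas hφ ht).of_le le_top).comp t h.1

/-- In a chart, a geodesic together with its velocity is an integral curve of the spray. -/
lemma IsGeodesicAt.hasDerivAt {γ : ℝ → X} {t : ℝ} (h : IsGeodesicAt g γ t)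
    (hφ : φ ∈ IsManifold.maximalAtlas (𝓡 m) ω X) (ht : γ t ∈ φ.source) :
    HasDerivAt (fun s => (φ (γ s), deriv (fun s => φ (γ s)) s))
      (sprayField (chartSpray g φ) (φ (γ t), deriv (fun s => φ (γ s)) t)) t := by
  have h1 := h.contDiffAt hφ ht
  have h2 := (ContDiffAt.eventually_hasDerivAt h1).self_of_nhds
  have h3 := (ContDiffAt.differentiableAt_deriv h1).hasDerivAt
  rw [(geodesicEq_chartMetric_iff hφ (c := fun s => φ (γ s)) (φ.map_source ht)).1
    (h.2 φ hφ ht)] at h3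
  exact h2.prodMk h3

/-- Two geodesics with the same initial position and velocity agree, as long as one of them stays
in the domain of a chart. -/
theorem geodesic_unique [T2Space X] (hφ : φ ∈ IsManifold.maximalAtlas (𝓡 m) ω X) {γ₁ γ₂ : ℝ → X}
    {δ : ℝ} (hδ : 0 < δ) (h₁ : ∀ t ∈ Ioo (-δ) (1 + δ), IsGeodesicAt g γ₁ t)
    (h₂ : ∀ t ∈ Ioo (-δ) (1 + δ), IsGeodesicAt g γ₂ t)
    (hsrc : ∀ t ∈ Icc (0 : ℝ) 1, γ₂ t ∈ φ.source) (h0 : γ₁ 0 = γ₂ 0)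
    (h0' : deriv (fun s => φ (γ₁ s)) 0 = deriv (fun s => φ (γ₂ s)) 0) : γ₁ 1 = γ₂ 1 := by
  -- The times at which positions and velocities agree form a closed and open set.
  let y₁ : ℝ → 𝔼[m] := deriv fun s => φ (γ₁ s)
  let y₂ : ℝ → 𝔼[m] := deriv fun s => φ (γ₂ s)
  let T : Set ℝ := {t | γ₁ t = γ₂ t ∧ y₁ t = y₂ t}
  have hI {t : ℝ} (ht : t ∈ Icc (0 : ℝ) 1) : Ioo (-δ) (1 + δ) ∈ 𝓝 t :=
    Ioo_mem_nhds (by linarith [ht.1]) (by linarith [ht.2])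
  have hcont₁ {t : ℝ} (ht : t ∈ Icc (0 : ℝ) 1) : ContinuousAt γ₁ t :=
    (h₁ t (mem_of_mem_nhds (hI ht))).1.continuousAt
  have hcont₂ {t : ℝ} (ht : t ∈ Icc (0 : ℝ) 1) : ContinuousAt γ₂ t :=
    (h₂ t (mem_of_mem_nhds (hI ht))).1.continuousAt
  have hclosed : IsClosed (T ∩ Icc 0 1) := by
    refine isClosed_of_closure_subset fun t ht => ?_
    have htI : t ∈ Icc (0 : ℝ) 1 :=
      isClosed_Icc.closure_subset_iff.2 inter_subset_right ht
    have hne : (𝓝[T ∩ Icc 0 1] t).NeBot := mem_closure_iff_nhdsWithin_neBot.1 ht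
    have hT : ∀ᶠ s in 𝓝[T ∩ Icc 0 1] t, s ∈ T :=
      eventually_mem_nhdsWithin.mono fun s hs => hs.1
    have e1 : γ₁ t = γ₂ t :=
      tendsto_nhds_unique_of_eventuallyEq ((hcont₁ htI).mono_left nhdsWithin_le_nhds)
        ((hcont₂ htI).mono_left nhdsWithin_le_nhds) (hT.mono fun s hs => hs.1)
    have c1 := (ContDiffAt.differentiableAt_deriv ((h₁ t (mem_of_mem_nhds (hI htI))).contDiffAt hφ
      (by rw [e1]; exact hsrc t htI))).continuousAt
    have c2 := (ContDiffAt.differentiableAt_deriv ((h₂ t (mem_of_mem_nhds (hI htI))).contDiffAt hφ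
      (hsrc t htI))).continuousAt
    have e2 : y₁ t = y₂ t :=
      tendsto_nhds_unique_of_eventuallyEq (c1.mono_left nhdsWithin_le_nhds)
        (c2.mono_left nhdsWithin_le_nhds) (hT.mono fun s hs => hs.2)
    exact ⟨⟨e1, e2⟩, htI⟩
  have hopen : ∀ t ∈ T ∩ Ico 0 1, T ∈ 𝓝[>] t := by
    intro t ht
    refine mem_nhdsWithin_of_mem_nhds ?_
    have htI := Ico_subset_Icc_self ht.2
    have s2 : ∀ᶠ s in 𝓝 t, γ₂ s ∈ φ.source :=
      (hcont₂ htI).eventually (φ.open_source.mem_nhds (hsrc t htI))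
    have s1 : ∀ᶠ s in 𝓝 t, γ₁ s ∈ φ.source :=
      (hcont₁ htI).eventually (φ.open_source.mem_nhds (by rw [ht.1.1]; exact hsrc t htI))
    have d1 : ∀ᶠ s in 𝓝 t, HasDerivAt (fun s => (φ (γ₁ s), y₁ s))
        (sprayField (chartSpray g φ) (φ (γ₁ s), y₁ s)) s := by
      filter_upwards [s1, hI htI] with s hs1 hs2
      exact (h₁ s hs2).hasDerivAt hφ hs1
    have d2 : ∀ᶠ s in 𝓝 t, HasDerivAt (fun s => (φ (γ₂ s), y₂ s))
        (sprayField (chartSpray g φ) (φ (γ₂ s), y₂ s)) s := by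
      filter_upwards [s2, hI htI] with s hs1 hs2
      exact (h₂ s hs2).hasDerivAt hφ hs1
    have e : (φ (γ₁ t), y₁ t) = (φ (γ₂ t), y₂ t) := by rw [ht.1.1, ht.1.2]
    have hS : ContDiffAt ℝ 1 (sprayField (chartSpray g φ)) (φ (γ₂ t), y₂ t) :=
      (contDiffAt_sprayField (contDiffAt_chartSpray hφ
        (φ.map_source (hsrc t htI)))).of_le le_top
    obtain ⟨K, s, hs, hK⟩ := hS.exists_lipschitzOnWith
    have m1 := d1.self_of_nhds.continuousAt.eventually (e ▸ hs)
    have m2 := d2.self_of_nhds.continuousAt.eventually hs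
    have huniq := ODE_solution_unique_of_eventually (v := fun _ => sprayField (chartSpray g φ))
      (s := fun _ => s) (K := K) (Eventually.of_forall fun _ => hK) (d1.and m1) (d2.and m2) e
    filter_upwards [huniq, s1, s2] with s hs hs1 hs2
    exact ⟨φ.injOn hs1 hs2 (congrArg Prod.fst hs), congrArg Prod.snd hs⟩
  have := hclosed.Icc_subset_of_forall_mem_nhdsWithin (a := 0) (b := 1) ⟨h0, h0'⟩ hopen
  exact (this (right_mem_Icc.2 zero_le_one)).1

omit [IsManifold (𝓡 m) ω X] in
lemma deriv_chart_comp (hφ : φ ∈ IsManifold.maximalAtlas (𝓡 m) ω X) {γ : ℝ → X}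
    (hγ : MDifferentiableAt 𝓘(ℝ, ℝ) (𝓡 m) γ 0) (h0 : γ 0 ∈ φ.source) :
    deriv (fun s => φ (γ s)) 0
      = (tangentMap (𝓡 m) (𝓡 m) φ (tangentMap 𝓘(ℝ, ℝ) (𝓡 m) γ ⟨0, (1 : ℝ)⟩)).2 := by
  have h1 := ((chart_mdifferentiable hφ).mdifferentiableAt h0).hasMFDerivAt.comp 0 hγ.hasMFDerivAt
  let D : ℝ →L[ℝ] 𝔼[m] :=
    (mfderiv (𝓡 m) (𝓡 m) φ (γ 0)).comp (mfderiv 𝓘(ℝ, ℝ) (𝓡 m) γ 0)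
  have h2 : HasFDerivAt (fun s => φ (γ s)) D 0 := h1.hasFDerivAt
  rw [← fderiv_apply_one_eq_deriv, h2.fderiv]
  rfl

end Uniqueness

/-! ### The exponential map in a chart -/

section SprayCurve

variable {F : Type*} [NormedAddCommGroup F] [NormedSpace ℝ F] {S : F → F →L[ℝ] F →L[ℝ] F}
  {x₀ : F} {W : Set (F × F)} {U : F × F → C(TimeInterval, F × F)} {r : ℝ} {z : F × F} {t : ℝ}

lemma IsSprayFlow.hasDerivAt_position (h : IsSprayFlow S x₀ W U r)
    (hz : z ∈ Metric.ball (x₀, (0 : F)) r) (ht : t ∈ Ioo (-1 : ℝ) 2) :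
    HasDerivAt (fun s => (pathExt (U z) s).1) (pathExt (U z) t).2 t :=
  (ContinuousLinearMap.fst ℝ F F).hasFDerivAt.comp_hasDerivAt t (h.hasDerivAt z hz t ht)

lemma IsSprayFlow.deriv_position (h : IsSprayFlow S x₀ W U r)
    (hz : z ∈ Metric.ball (x₀, (0 : F)) r) (ht : t ∈ Ioo (-1 : ℝ) 2) :
    deriv (fun s => (pathExt (U z) s).1) =ᶠ[𝓝 t] fun s => (pathExt (U z) s).2 := by
  filter_upwards [Ioo_mem_nhds ht.1 ht.2] with s hs
  exact (h.hasDerivAt_position hz hs).deriv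

lemma IsSprayFlow.deriv_deriv_position (h : IsSprayFlow S x₀ W U r)
    (hz : z ∈ Metric.ball (x₀, (0 : F)) r) (ht : t ∈ Ioo (-1 : ℝ) 2) :
    deriv (deriv fun s => (pathExt (U z) s).1) t
      = S (pathExt (U z) t).1 (deriv (fun s => (pathExt (U z) s).1) t)
        (deriv (fun s => (pathExt (U z) s).1) t) := by
  have h1 := h.deriv_position hz ht
  rw [h1.deriv_eq, h1.self_of_nhds]
  exact ((ContinuousLinearMap.snd ℝ F F).hasFDerivAt.comp_hasDerivAt t
    (h.hasDerivAt z hz t ht)).deriv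

lemma IsSprayFlow.contDiffAt_position (h : IsSprayFlow S x₀ W U r)
    (hS : ∀ w ∈ W, ContinuousAt S w.1) (hz : z ∈ Metric.ball (x₀, (0 : F)) r)
    (ht : t ∈ Ioo (-1 : ℝ) 2) : ContDiffAt ℝ 2 (fun s => (pathExt (U z) s).1) t := by
  have hcont : ContinuousOn (fun s => sprayField S (pathExt (U z) s)) (Ioo (-1) 2) := by
    intro s _
    refine ContinuousAt.continuousWithinAt ?_
    have h1 : ContinuousAt (sprayField S) (pathExt (U z) s) := by
      have hc := hS _ (h.mem z hz s)
      unfold sprayField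
      exact continuousAt_snd.prodMk (((ContinuousAt.comp (f := Prod.fst) hc
        continuousAt_fst).clm_apply continuousAt_snd).clm_apply continuousAt_snd)
    exact ContinuousAt.comp (g := sprayField S) h1 (continuous_pathExt _).continuousAt
  have hI := Ioo_mem_nhds ht.1 ht.2
  let L : (F × F) →L[ℝ] (ℝ →L[ℝ] F × F) :=
    ContinuousLinearMap.smulRightL ℝ ℝ (F × F) (ContinuousLinearMap.id ℝ ℝ)
  have h1 : ContDiffAt ℝ 1 (pathExt (U z)) t := by
    rw [contDiffAt_one_iff]
    refine ⟨fun s => L (sprayField S (pathExt (U z) s)), _, hI,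
      L.continuous.comp_continuousOn hcont, fun s hs => ?_⟩
    exact (h.hasDerivAt z hz s hs).hasFDerivAt
  have h2 : (2 : WithTop ℕ∞) = 1 + 1 := by norm_num
  rw [h2]
  refine (contDiffAt_succ_iff_hasFDerivAt (n := 1)).2
    ⟨fun s => ContinuousLinearMap.smulRightL ℝ ℝ F (ContinuousLinearMap.id ℝ ℝ)
      (pathExt (U z) s).2, ⟨_, hI, fun s hs => ?_⟩, ?_⟩
  · exact (h.hasDerivAt_position hz hs).hasFDerivAt
  · exact (ContinuousLinearMap.contDiff _).contDiffAt.comp t (contDiffAt_snd.comp t h1)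

end SprayCurve

section Exponential

variable [IsManifold (𝓡 m) ω X] {g : AnalyticMetric m X} {φ : OpenPartialHomeomorph X 𝔼[m]}
  {x₀ : 𝔼[m]} {W : Set (𝔼[m] × 𝔼[m])} {U : 𝔼[m] × 𝔼[m] → C(TimeInterval, 𝔼[m] × 𝔼[m])} {r : ℝ}

lemma IsSprayFlow.isGeodesicAt (hφ : φ ∈ IsManifold.maximalAtlas (𝓡 m) ω X)
    (h : IsSprayFlow (chartSpray g φ) x₀ W U r) (hW : ∀ w ∈ W, w.1 ∈ φ.target)
    {z : 𝔼[m] × 𝔼[m]} (hz : z ∈ Metric.ball (x₀, (0 : 𝔼[m])) r) {t : ℝ}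
    (ht : t ∈ Ioo (-1 : ℝ) 2) :
    IsGeodesicAt g (fun s => φ.symm (pathExt (U z) s).1) t := by
  have hct := hW _ (h.mem z hz t)
  refine isGeodesicAt_symm_comp hφ (h.contDiffAt_position (fun w hw =>
    (contDiffAt_chartSpray hφ (hW w hw)).continuousAt) hz ht) hct ?_
  rw [geodesicEq_chartMetric_iff hφ hct]
  exact h.deriv_deriv_position hz ht

/-- The geodesics computed by the spray flow in a chart are witnesses for the exponential map. -/
lemma IsSprayFlow.isExpValue (hφ : φ ∈ IsManifold.maximalAtlas (𝓡 m) ω X)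
    (h : IsSprayFlow (chartSpray g φ) x₀ W U r) (hW : ∀ w ∈ W, w.1 ∈ φ.target)
    (η : (p : X) → TangentSpace (𝓡 m) p) {x : 𝔼[m]}
    (hz : (x, localRep φ η x) ∈ Metric.ball (x₀, (0 : 𝔼[m])) r) :
    IsExpValue g ⟨φ.symm x, η (φ.symm x)⟩
      (φ.symm (pathExt (U (x, localRep φ η x)) 1).1) := by
  set z := (x, localRep φ η x)
  have h0 := h.init z hz
  have hxt : x ∈ φ.target := by
    have := hW _ (h.mem z hz 0)
    rwa [h0] at this
  have hc0 : (fun s => (pathExt (U z) s).1) 0 = x := congrArg Prod.fst h0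
  refine ⟨fun s => φ.symm (pathExt (U z) s).1, 1, one_pos, fun t ht =>
    h.isGeodesicAt hφ hW hz ⟨ht.1, by linarith [ht.2]⟩, ?_, rfl⟩
  have h1 : HasMFDerivAt 𝓘(ℝ, ℝ) (𝓡 m) (fun s => (pathExt (U z) s).1) 0 _ :=
    (h.hasDerivAt_position hz (t := 0) (by norm_num)).hasFDerivAt.hasMFDerivAt
  have h2 := ((chart_mdifferentiable hφ).mdifferentiableAt_symm (x := (fun s =>
    (pathExt (U z) s).1) 0) (by rw [hc0]; exact hxt)).hasMFDerivAt
  have h3 := (h2.comp 0 h1).mfderiv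
  have h4 : tangentMap 𝓘(ℝ, ℝ) (𝓡 m) (φ.symm ∘ fun s => (pathExt (U z) s).1) ⟨0, (1 : ℝ)⟩
      = tangentMap (𝓡 m) (𝓡 m) φ.symm ⟨(pathExt (U z) 0).1, (pathExt (U z) 0).2⟩ := by
    simp only [tangentMap, h3]
    congr 1
    change (mfderiv (𝓡 m) (𝓡 m) φ.symm (pathExt (U z) 0).1)
      ((1 : ℝ) • (pathExt (U z) 0).2) = _
    rw [one_smul]
  refine h4.trans ?_
  rw [h0]
  have h5 := DFunLike.congr_fun ((chart_mdifferentiable hφ).symm_comp_deriv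
    (φ.map_target hxt)) (η (φ.symm x))
  have h6 : mfderiv (𝓡 m) (𝓡 m) φ.symm x (localRep φ η x) = η (φ.symm x) := by
    have : φ (φ.symm x) = x := φ.right_inv hxt
    rw [this] at h5
    exact h5
  exact congrArg (fun v => (⟨φ.symm x, v⟩ : TangentBundle (𝓡 m) X)) h6

/-- By uniqueness of geodesics, the value chosen in `riemExp` is the one given by the flow. -/
lemma IsSprayFlow.riemExp_eq [T2Space X] (hφ : φ ∈ IsManifold.maximalAtlas (𝓡 m) ω X)
    (h : IsSprayFlow (chartSpray g φ) x₀ W U r) (hW : ∀ w ∈ W, w.1 ∈ φ.target)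
    (η : (p : X) → TangentSpace (𝓡 m) p) {x : 𝔼[m]}
    (hz : (x, localRep φ η x) ∈ Metric.ball (x₀, (0 : 𝔼[m])) r) :
    psi g η (φ.symm x) = φ.symm (pathExt (U (x, localRep φ η x)) 1).1 := by
  set z := (x, localRep φ η x)
  have hex : ∃ q, IsExpValue g ⟨φ.symm x, η (φ.symm x)⟩ q := ⟨_, h.isExpValue hφ hW η hz⟩
  have h0 := h.init z hz
  have hsrc (t : ℝ) : φ.symm (pathExt (U z) t).1 ∈ φ.source :=
    φ.map_target (hW _ (h.mem z hz t))
  have key : ∀ q, IsExpValue g ⟨φ.symm x, η (φ.symm x)⟩ q → q = φ.symm (pathExt (U z) 1).1 := by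
    rintro q ⟨γ, δ, hδ, hγ, hv, rfl⟩
    have hγ0 : γ 0 = φ.symm x := congrArg Bundle.TotalSpace.proj hv
    have hx : φ.symm x ∈ φ.source := by simpa only [h0] using hsrc 0
    have hδ' : 0 < min δ 1 := lt_min hδ one_pos
    have hmd : MDifferentiableAt 𝓘(ℝ, ℝ) (𝓡 m) γ 0 :=
      (hγ 0 ⟨by linarith, by linarith⟩).1.mdifferentiableAt (by simp)
    refine geodesic_unique (g := g) hφ (γ₂ := fun s => φ.symm (pathExt (U z) s).1) hδ'
      (fun t ht => hγ t ⟨?_, ?_⟩) (fun t ht => h.isGeodesicAt hφ hW hz ⟨?_, ?_⟩)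
      (fun t _ => hsrc t) (by rw [hγ0, h0]) ?_
    · linarith [ht.1, min_le_left δ 1]
    · linarith [ht.2, min_le_left δ 1]
    · linarith [ht.1, min_le_right δ 1]
    · linarith [ht.2, min_le_right δ 1]
    · rw [deriv_chart_comp hφ hmd (by rw [hγ0]; exact hx), hv]
      have h1 : (fun s => φ (φ.symm (pathExt (U z) s).1)) = fun s => (pathExt (U z) s).1 := by
        ext1 s
        exact φ.right_inv (hW _ (h.mem z hz s))
      rw [h1, (h.hasDerivAt_position hz (t := 0) (by norm_num)).deriv, h0]
      rfl
  unfold psi riemExp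
  rw [dif_pos hex]
  exact key _ hex.choose_spec

end Exponential

/-! ### Independence of the index of the chart -/

section Index

lemma finrank_faceSpace_add_cornerIndex (k : ℕ) (x : 𝔼[m]) :
    Module.finrank ℝ (faceSpace k x) + cornerIndex k x = m := by
  classical
  let s : Set (Fin m) := {i | i.val < k ∧ x i = 0}
  let R : 𝔼[m] →ₗ[ℝ] (s → ℝ) := LinearMap.pi fun i => (EuclideanSpace.proj i.1 : 𝔼[m] →L[ℝ] ℝ)
  have hR (v : 𝔼[m]) (i : s) : R v i = v i.1 := rfl
  have hker : LinearMap.ker R = faceSpace k x := by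
    ext v
    rw [LinearMap.mem_ker]
    constructor
    · intro h i hi hx
      exact congrFun h ⟨i, hi, hx⟩
    · intro h
      ext i
      exact h i.1 i.2.1 i.2.2
  have hrange : LinearMap.range R = ⊤ := by
    rw [LinearMap.range_eq_top]
    intro f
    refine ⟨WithLp.toLp 2 fun i => if h : i ∈ s then f ⟨i, h⟩ else 0, ?_⟩
    ext i
    rw [hR]
    simp
  have h1 := LinearMap.finrank_range_add_finrank_ker R
  rw [hker, hrange, finrank_top, Module.finrank_pi, finrank_euclideanSpace_fin] at h1
  have h2 : cornerIndex k x = Fintype.card s := by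
    rw [← Nat.card_eq_fintype_card, Nat.card_coe_set_eq]
    rfl
  omega

variable {M : Set X} {k k' : ℕ} {φ ψ : OpenPartialHomeomorph X 𝔼[m]}

lemma IsEnvelopingChart.symm_mem (h : IsEnvelopingChart M k φ) {x : 𝔼[m]} (hx : x ∈ φ.target)
    (hx' : x ∈ modelCorner m k) : φ.symm x ∈ M := by
  have : x ∈ φ '' (φ.source ∩ M) := by rw [h.2.2]; exact ⟨hx, hx'⟩
  obtain ⟨p, hp, rfl⟩ := this
  rw [φ.left_inv hp.1]
  exact hp.2

lemma IsEnvelopingChart.apply_mem (h : IsEnvelopingChart M k φ) {p : X} (hp : p ∈ φ.source)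
    (hpM : p ∈ M) : φ p ∈ modelCorner m k := by
  have : φ p ∈ φ '' (φ.source ∩ M) := ⟨p, ⟨hp, hpM⟩, rfl⟩
  rw [h.2.2] at this
  exact this.2

/-- The differential of a transition map preserves the tangent spaces of the strata: a curve in a
stratum stays in the corner on both sides of time `0`, hence the vanishing coordinates of its image
have a minimum there. -/
lemma fderiv_transition_mem_faceSpace (hφ : IsEnvelopingChart M k φ)
    (hψ : IsEnvelopingChart M k' ψ) {x : 𝔼[m]} (hx : x ∈ φ.target) (hxc : x ∈ modelCorner m k)
    (hx' : φ.symm x ∈ ψ.source) {v : 𝔼[m]} (hv : v ∈ faceSpace k x) :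
    fderiv ℝ (fun y => ψ (φ.symm y)) x v ∈ faceSpace k' (ψ (φ.symm x)) := by
  intro i hi hi0
  have hline : HasDerivAt (fun s : ℝ => x + s • v) v 0 := by
    simpa using ((hasDerivAt_id (0 : ℝ)).smul_const v).const_add x
  have hlc : Tendsto (fun s : ℝ => x + s • v) (𝓝 0) (𝓝 x) := by
    simpa using hline.continuousAt.tendsto
  have hd : HasDerivAt (fun s : ℝ => ψ (φ.symm (x + s • v)) i)
      (fderiv ℝ (fun y => ψ (φ.symm y)) x v i) 0 := by
    have h1 := ((contDiffAt_transition hφ.2.1 hψ.2.1 hx hx').differentiableAt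
      (by simp)).hasFDerivAt
    have h2 := HasFDerivAt.comp_hasDerivAt (l := fun y => ψ (φ.symm y)) (0 : ℝ)
      (by simpa using h1) hline
    exact (EuclideanSpace.proj i : 𝔼[m] →L[ℝ] ℝ).hasFDerivAt.comp_hasDerivAt (0 : ℝ) h2
  refine IsLocalMin.hasDerivAt_eq_zero (f := fun s : ℝ => ψ (φ.symm (x + s • v)) i) ?_ hd
  have hcorner : ∀ᶠ s in 𝓝 (0 : ℝ), x + s • v ∈ modelCorner m k := by
    have : ∀ l : Fin m, ∀ᶠ s in 𝓝 (0 : ℝ), l.val < k → 0 ≤ (x + s • v) l := by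
      intro l
      by_cases hl : l.val < k
      · by_cases hl0 : x l = 0
        · refine Eventually.of_forall fun s _ => ?_
          simp [hl0, hv l hl hl0]
        · have hpos : 0 < x l := lt_of_le_of_ne (hxc l hl) (Ne.symm hl0)
          have := (continuous_coord l).continuousAt.tendsto.comp hlc
          exact (this.eventually (lt_mem_nhds hpos)).mono fun s hs _ => hs.le
      · exact Eventually.of_forall fun s h => absurd h hl
    exact eventually_all.2 this
  have hψs : ∀ᶠ s in 𝓝 (0 : ℝ), φ.symm (x + s • v) ∈ ψ.source :=
    ((φ.continuousAt_symm hx).tendsto.comp hlc).eventually (ψ.open_source.mem_nhds hx')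
  filter_upwards [hcorner, hψs, hlc.eventually (φ.open_target.mem_nhds hx)] with s h1 h2 h3
  simp only [zero_smul, add_zero]
  rw [hi0]
  exact hψ.apply_mem h2 (hφ.symm_mem h3 h1) i hi

/-- By `fderiv_transition_mem_faceSpace`, the differential of the transition map embeds one tangent
space of the stratum into the other; the dimensions are `m` minus the indices. -/
lemma cornerIndex_le_of_charts (hφ : IsEnvelopingChart M k φ) (hψ : IsEnvelopingChart M k' ψ)
    {p : X} (hp : p ∈ M) (hpφ : p ∈ φ.source) (hpψ : p ∈ ψ.source) :
    cornerIndex k' (ψ p) ≤ cornerIndex k (φ p) := by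
  have hx := φ.map_source hpφ
  have hback := φ.left_inv hpφ
  have hx' : φ.symm (φ p) ∈ ψ.source := by rwa [hback]
  have h1 := finrank_faceSpace_add_cornerIndex k (φ p)
  have h2 := finrank_faceSpace_add_cornerIndex k' (ψ p)
  let D : 𝔼[m] →ₗ[ℝ] 𝔼[m] := (fderiv ℝ (fun y => ψ (φ.symm y)) (φ p)).toLinearMap
  have hD : ∀ v ∈ faceSpace k (φ p), D v ∈ faceSpace k' (ψ p) := by
    intro v hv
    have := fderiv_transition_mem_faceSpace hφ hψ hx (hφ.apply_mem hpφ hp) hx' hv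
    rwa [hback] at this
  have hinj : Function.Injective (D.restrict hD) := by
    have hsurj : Function.Surjective D := fun v =>
      ⟨_, fderiv_transition_comp hφ.2.1 hψ.2.1 hx hx' v⟩
    have hDinj : Function.Injective D := LinearMap.injective_iff_surjective.2 hsurj
    intro a b hab
    exact Subtype.ext (hDinj (congrArg Subtype.val hab))
  have h3 := LinearMap.finrank_le_finrank_of_injective hinj
  omega

/-- The index of a point can be computed in any enveloping chart. -/
lemma IsEnvelopingChart.mem_stratum_iff (hφ : IsEnvelopingChart M k φ) {p : X}
    (hpφ : p ∈ φ.source) {j : ℕ} : p ∈ stratum m M j ↔ p ∈ M ∧ cornerIndex k (φ p) = j := by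
  constructor
  · rintro ⟨hp, k', ψ, hψ, hpψ, rfl⟩
    exact ⟨hp, (cornerIndex_le_of_charts hψ hφ hp hpψ hpφ).antisymm
      (cornerIndex_le_of_charts hφ hψ hp hpφ hpψ)⟩
  · rintro ⟨hp, h⟩
    exact ⟨hp, k, φ, hφ, hpφ, h⟩

end Index

/-! ### The spray is tangent to the totally geodesic faces -/

section Face

variable [IsManifold (𝓡 m) ω X] {g : AnalyticMetric m X} {M : Set X} {k : ℕ}
  {φ : OpenPartialHomeomorph X 𝔼[m]}

/-- A constructor for `IsStratumGeodesicAt` in which the subspace is given only up to equality. -/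
lemma isStratumGeodesicAt_of_eq (hφ : IsEnvelopingChart M k φ) {j : ℕ} {γ : ℝ → X} {t : ℝ}
    (ht : γ t ∈ φ.source) {F : Submodule ℝ 𝔼[m]} (hF : faceSpace k (φ (γ t)) = F) (c : ℝ → F)
    (hc : ∀ᶠ s in 𝓝 t, γ s ∈ φ.source ∩ stratum m M j ∧ φ (γ s) = (c s : 𝔼[m]))
    (hc2 : ContDiffAt ℝ 2 c t)
    (hgeo : GeodesicEq (fun x u v : F => chartMetric g φ (x : 𝔼[m]) (u : 𝔼[m]) (v : 𝔼[m])) c t) :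
    IsStratumGeodesicAt g M j γ t := by
  subst hF
  exact ⟨k, φ, hφ, ht, c, hc, hc2, hgeo⟩

/-- The restriction of a bilinear form to a subspace. -/
def restrictForm (F : Submodule ℝ 𝔼[m]) (B : 𝔼[m] →L[ℝ] 𝔼[m] →L[ℝ] ℝ) : F →L[ℝ] F →L[ℝ] ℝ :=
  ((ContinuousLinearMap.compL ℝ F 𝔼[m] ℝ).flip F.subtypeL).comp (B.comp F.subtypeL)

lemma restrictForm_apply (F : Submodule ℝ 𝔼[m]) (B : 𝔼[m] →L[ℝ] 𝔼[m] →L[ℝ] ℝ) (u v : F) :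
    restrictForm F B u v = B u v := rfl

lemma contDiffAt_restrictForm (F : Submodule ℝ 𝔼[m])
    (hφ : φ ∈ IsManifold.maximalAtlas (𝓡 m) ω X) {y : F} (hy : (y : 𝔼[m]) ∈ φ.target) :
    ContDiffAt ℝ ω (fun y : F => restrictForm F (chartForm g φ y)) y := by
  have h1 : ContDiffAt ℝ ω (fun y : F => chartForm g φ y) y :=
    ContDiffAt.comp (g := chartForm g φ) (f := fun y : F => (y : 𝔼[m])) y
      (contDiffAt_chartForm hφ hy) F.subtypeL.contDiff.contDiffAt
  exact contDiffAt_const.clm_comp (h1.clm_comp contDiffAt_const)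

lemma restrictForm_chartForm_pos (F : Submodule ℝ 𝔼[m])
    (hφ : φ ∈ IsManifold.maximalAtlas (𝓡 m) ω X) {y : F} (hy : (y : 𝔼[m]) ∈ φ.target) (w : F)
    (hw : w ≠ 0) : 0 < restrictForm F (chartForm g φ y) w w := by
  rw [restrictForm_apply]
  exact chartForm_pos (g := g) hφ hy w fun h => hw (Subtype.ext h)

/-- The points of an open face have the same tangent space. -/
lemma faceSpace_eq_of_unique {x y : 𝔼[m]} {l : Fin m} (hx0 : x l = 0)
    (hx : ∀ i : Fin m, i.val < k → i ≠ l → 0 < x i) (hy0 : y l = 0)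
    (hy : ∀ i : Fin m, i.val < k → i ≠ l → 0 < y i) : faceSpace k y = faceSpace k x := by
  ext v
  refine forall_congr' fun i => forall_congr' fun hi => ?_
  by_cases hil : i = l
  · subst hil
    simp [hx0, hy0]
  · simp [(hx i hi hil).ne', (hy i hi hil).ne']

lemma isOpen_setOf_pos (k : ℕ) (l : Fin m) :
    IsOpen {y : 𝔼[m] | ∀ i : Fin m, i.val < k → i ≠ l → 0 < y i} := by
  rw [isOpen_iff_mem_nhds]
  intro y hy
  have : ∀ᶠ y' in 𝓝 y, ∀ i : Fin m, i.val < k → i ≠ l → 0 < y' i := by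
    rw [eventually_all]
    intro i
    by_cases hi : i.val < k ∧ i ≠ l
    · exact ((continuous_coord i).continuousAt.eventually (lt_mem_nhds (hy i hi.1 hi.2))).mono
        fun y' hy' _ _ => hy'
    · exact Eventually.of_forall fun y' h1 h2 => absurd ⟨h1, h2⟩ hi
  exact this

lemma cornerIndex_eq_one {x : 𝔼[m]} {l : Fin m} (hl : l.val < k) (hx0 : x l = 0)
    (hx : ∀ i : Fin m, i.val < k → i ≠ l → 0 < x i) : cornerIndex k x = 1 := by
  unfold cornerIndex
  rw [ncard_eq_one]
  refine ⟨l, ?_⟩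
  ext i
  simp only [mem_ofPred_eq, mem_singleton_iff]
  constructor
  · rintro ⟨hi, hi0⟩
    by_contra hil
    exact (hx i hi hil).ne' hi0
  · rintro rfl
    exact ⟨hl, hx0⟩

/-- A solution of the geodesic equation of the induced metric in an open face is a geodesic of the
stratum of index one. The subspace `F` is kept variable, since `faceSpace` at the points of the
curve is only propositionally constant. -/
lemma isStratumGeodesicAt_symm_comp (hφ : IsEnvelopingChart M k φ) {F : Submodule ℝ 𝔼[m]} {x : 𝔼[m]}
    (hF : F = faceSpace k x) {l : Fin m} (hl : l.val < k) (hx0 : x l = 0)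
    (hx : ∀ i : Fin m, i.val < k → i ≠ l → 0 < x i) (c : ℝ → F)
    (hct : ∀ s, (c s : 𝔼[m]) ∈ φ.target)
    (hc : ∀ s, ∀ i : Fin m, i.val < k → i ≠ l → 0 < (c s : 𝔼[m]) i) {t : ℝ}
    (hc2 : ContDiffAt ℝ 2 c t)
    (hgeo : GeodesicEq (fun x u v : F => chartMetric g φ (x : 𝔼[m]) (u : 𝔼[m]) (v : 𝔼[m])) c t) :
    IsStratumGeodesicAt g M 1 (fun s => φ.symm (c s)) t := by
  have hc0 (s : ℝ) : (c s : 𝔼[m]) l = 0 := hF.le (c s).2 l hl hx0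
  have hφc (s : ℝ) : φ (φ.symm (c s)) = c s := φ.right_inv (hct s)
  have hcorner (s : ℝ) : (c s : 𝔼[m]) ∈ modelCorner m k := by
    intro i hi
    by_cases hil : i = l
    · rw [hil, hc0]
    · exact (hc s i hi hil).le
  have hface : faceSpace k (φ (φ.symm (c t))) = F := by
    rw [hφc]
    refine Eq.trans ?_ hF.symm
    exact faceSpace_eq_of_unique hx0 hx (hc0 t) (hc t)
  have hev (s : ℝ) : φ.symm (c s) ∈ φ.source ∩ stratum m M 1 ∧ φ (φ.symm (c s)) = c s := by
    refine ⟨⟨φ.map_target (hct s), hφ.symm_mem (hct s) (hcorner s), k, φ, hφ,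
      φ.map_target (hct s), ?_⟩, hφc s⟩
    rw [hφc]
    exact cornerIndex_eq_one hl (hc0 s) (hc s)
  exact isStratumGeodesicAt_of_eq hφ (γ := fun s => φ.symm (c s)) (φ.map_target (hct t)) hface c
    (Eventually.of_forall hev) hc2 hgeo

/-- At a point of the stratum of index one, the spray is tangent to the stratum: the geodesics of
the stratum are geodesics of `X`, and their second derivatives in the chart are tangent. -/
lemma chartSpray_normal_eq_zero (hg : StratumTotallyGeodesic g M 1) (hφ : IsEnvelopingChart M k φ)
    {x : 𝔼[m]} (hxt : x ∈ φ.target) {l : Fin m} (hl : l.val < k) (hx0 : x l = 0)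
    (hx : ∀ i : Fin m, i.val < k → i ≠ l → 0 < x i) {v : 𝔼[m]} (hv : v l = 0) :
    chartSpray g φ x v v l = 0 := by
  have hmem : ∀ w : 𝔼[m], w l = 0 → w ∈ faceSpace k x := by
    intro w hw i hi hi0
    by_cases hil : i = l
    · rw [hil]; exact hw
    · exact absurd hi0 (hx i hi hil).ne'
  obtain ⟨F, hF⟩ : ∃ F, F = faceSpace k x := ⟨_, rfl⟩
  rw [← hF] at hmem
  have hFl (w : F) : (w : 𝔼[m]) l = 0 := hF.le w.2 l hl hx0
  let xF : F := ⟨x, hmem x hx0⟩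
  let A : F → F →L[ℝ] F →L[ℝ] ℝ := fun y => restrictForm F (chartForm g φ y)
  have hA (y : F) (hy : (y : 𝔼[m]) ∈ φ.target) : ContDiffAt ℝ ω A y :=
    contDiffAt_restrictForm F hφ.2.1 hy
  have hApos (y : F) (hy : (y : 𝔼[m]) ∈ φ.target) (w : F) (hw : w ≠ 0) : 0 < A y w w :=
    restrictForm_chartForm_pos F hφ.2.1 hy w hw
  let O : Set F := Subtype.val ⁻¹' (φ.target ∩ {y | ∀ i : Fin m, i.val < k → i ≠ l → 0 < y i})
  have hO : IsOpen O :=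
    (φ.open_target.inter (isOpen_setOf_pos k l)).preimage
      continuous_subtype_val
  have hxO : xF ∈ O := ⟨hxt, hx⟩
  have hOpos {y : F} (hy : y ∈ O) (i : Fin m) (hi : i.val < k) (hil : i ≠ l) :
      0 < (y : 𝔼[m]) i := hy.2 i hi hil
  have hS (y : F) (hy : y ∈ O) : ContDiffAt ℝ ω (metricSpray A) y :=
    contDiffAt_metricSpray (hA y hy.1) (hApos y hy.1)
  obtain ⟨U, r, hU⟩ := exists_isSprayFlow (hS xF hxO)
    (continuousAt_fst.preimage_mem_nhds (x := (xF, (0 : F))) (hO.mem_nhds hxO))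
  -- The flow exists only for small velocities, and the claim is homogeneous in `v`.
  obtain ⟨a, ha, har⟩ : ∃ a : ℝ, 0 < a ∧ ‖a • (⟨v, hmem v hv⟩ : F)‖ < r := by
    have h1 : Tendsto (fun a : ℝ => ‖a • (⟨v, hmem v hv⟩ : F)‖) (𝓝 0) (𝓝 0) := by
      have : Continuous fun a : ℝ => ‖a • (⟨v, hmem v hv⟩ : F)‖ := by fun_prop
      simpa using this.tendsto 0
    have h2 : ∀ᶠ a in 𝓝[>] (0 : ℝ), ‖a • (⟨v, hmem v hv⟩ : F)‖ < r :=
      (h1.eventually (gt_mem_nhds hU.pos)).filter_mono nhdsWithin_le_nhds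
    obtain ⟨a, h3, h4⟩ := (h2.and self_mem_nhdsWithin).exists
    exact ⟨a, h4, h3⟩
  let z : F × F := (xF, a • ⟨v, hmem v hv⟩)
  have hz : z ∈ Metric.ball (xF, (0 : F)) r := by
    rw [← ball_prod_same]
    exact ⟨Metric.mem_ball_self hU.pos, mem_ball_zero_iff.2 har⟩
  let c : ℝ → F := fun s => (pathExt (U z) s).1
  have hcO (s : ℝ) : c s ∈ O := hU.mem z hz s
  have hφc (s : ℝ) : φ (φ.symm (c s)) = c s := φ.right_inv (hcO s).1
  have hc2 {t : ℝ} (ht : t ∈ Ioo (-1 : ℝ) 2) : ContDiffAt ℝ 2 c t :=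
    hU.contDiffAt_position (fun w hw => (hS _ hw).continuousAt) hz ht
  have hstr : ∀ t ∈ Ioo (-1 : ℝ) 2, IsStratumGeodesicAt g M 1 (fun s => φ.symm (c s)) t := by
    intro t ht
    refine isStratumGeodesicAt_symm_comp hφ hF hl hx0 hx c (fun s => (hcO s).1)
      (fun s => hOpos (hcO s)) (hc2 ht) ?_
    have hct := (hcO t).1
    exact (geodesicEq_iff (A := A) (Eventually.of_forall fun _ _ _ => rfl)
      ((hA _ hct).differentiableAt (by simp)) (hApos _ hct)).2 (hU.deriv_deriv_position hz ht)
  have hgeo : IsGeodesicAt g (fun s => φ.symm (c s)) 0 :=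
    hg (fun s => φ.symm (c s)) (-1) 2 hstr 0 (by norm_num)
  have hφγ : (fun s => φ (φ.symm (c s))) = fun s => F.subtypeL (c s) := funext hφc
  have h0 : (0 : ℝ) ∈ Ioo (-1 : ℝ) 2 := by norm_num
  have hd1 : deriv (fun s => F.subtypeL (c s)) =ᶠ[𝓝 0] fun s => F.subtypeL (deriv c s) := by
    filter_upwards [ContDiffAt.eventually_hasDerivAt (hc2 h0)] with s hs
    exact (F.subtypeL.hasFDerivAt.comp_hasDerivAt s hs).deriv
  have hd2 : deriv (deriv fun s => F.subtypeL (c s)) 0 = F.subtypeL (deriv (deriv c) 0) := by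
    rw [hd1.deriv_eq]
    exact (F.subtypeL.hasFDerivAt.comp_hasDerivAt (0 : ℝ)
      (ContDiffAt.differentiableAt_deriv (hc2 h0)).hasDerivAt).deriv
  have hc0 : (c 0 : 𝔼[m]) = x := by
    have : c 0 = xF := congrArg Prod.fst (hU.init z hz)
    rw [this]
  have hdc0 : deriv c 0 = a • ⟨v, hmem v hv⟩ :=
    (hU.hasDerivAt_position hz h0).deriv.trans (congrArg Prod.snd (hU.init z hz))
  have h1 := hgeo.2 φ hφ.2.1 (φ.map_target (hcO 0).1)
  rw [hφγ, geodesicEq_chartMetric_iff hφ.2.1 (c := fun s => F.subtypeL (c s)) (hcO 0).1, hd2,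
    hd1.self_of_nhds] at h1
  simp only [hdc0] at h1
  have h2 : chartSpray g φ x (a • v) (a • v) l = 0 := by
    have h3 := congrArg (fun w : 𝔼[m] => w l) h1
    have h4 : chartSpray g φ (c 0 : 𝔼[m]) (a • v) (a • v) l = 0 := h3.symm.trans (hFl _)
    rwa [hc0] at h4
  simp only [map_smul, smul_apply, PiLp.smul_apply, smul_eq_mul] at h2
  simpa [ha.ne'] using h2

/-- The normal component of the spray vanishes on the whole hyperplane that contains a face, near
a given point of the face. On the open face this is `chartSpray_normal_eq_zero`, and the identity
theorem for analytic functions extends it to the hyperplane. -/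
lemma eventually_chartSpray_normal_eq_zero (hg : StratumTotallyGeodesic g M 1)
    (hφ : IsEnvelopingChart M k φ) {x₀ : 𝔼[m]} (hx₀t : x₀ ∈ φ.target) (hx₀ : x₀ ∈ modelCorner m k)
    {l : Fin m} (hl : l.val < k) (hl0 : x₀ l = 0) :
    ∀ᶠ x in 𝓝 x₀, ∀ v,
      chartSpray g φ (dropCoord l x) (dropCoord l v) (dropCoord l v) l = 0 := by
  obtain ⟨ρ, hρ, hb⟩ := Metric.isOpen_iff.1 φ.open_target x₀ hx₀t
  filter_upwards [Metric.ball_mem_nhds x₀ hρ] with x hx v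
  have hdrop {y : 𝔼[m]} (hy : y ∈ Metric.ball x₀ ρ) : dropCoord l y ∈ φ.target :=
    hb (dropCoord_mem_ball hl0 hy)
  let f : 𝔼[m] → ℝ := fun y => chartSpray g φ (dropCoord l y) (dropCoord l v) (dropCoord l v) l
  have hf : AnalyticOnNhd ℝ f (Metric.ball x₀ ρ) := by
    intro y hy
    have h1 : ContDiffAt ℝ ω (fun y => chartSpray g φ (dropCoord l y)) y :=
      (contDiffAt_chartSpray hφ.2.1 (hdrop hy)).comp y (dropCoord l).contDiff.contDiffAt
    have h2 := (h1.clm_apply (contDiffAt_const (c := dropCoord l v))).clm_apply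
      (contDiffAt_const (c := dropCoord l v))
    exact ((EuclideanSpace.proj l : 𝔼[m] →L[ℝ] ℝ).contDiff.contDiffAt.comp y h2).analyticAt
  -- A point in the interior of the corner near `x₀`.
  let e : 𝔼[m] := WithLp.toLp 2 fun _ => 1
  obtain ⟨a, ha, hae⟩ : ∃ a : ℝ, 0 < a ∧ x₀ + a • e ∈ Metric.ball x₀ ρ := by
    have h1 : Continuous fun a : ℝ => x₀ + a • e := by fun_prop
    have h2 : ∀ᶠ a in 𝓝[>] (0 : ℝ), x₀ + a • e ∈ Metric.ball x₀ ρ :=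
      (h1.tendsto 0).eventually (Metric.isOpen_ball.mem_nhds (by simpa using hρ))
        |>.filter_mono nhdsWithin_le_nhds
    obtain ⟨a, h3, h4⟩ := (h2.and self_mem_nhdsWithin).exists
    exact ⟨a, h4, h3⟩
  refine hf.eqOn_zero_of_preconnected_of_eventuallyEq_zero (convex_ball x₀ ρ).isPreconnected hae
    ?_ hx
  filter_upwards [eventually_coord_pos hx₀ ha, Metric.isOpen_ball.mem_nhds hae] with y hy hyb
  exact chartSpray_normal_eq_zero hg hφ (hdrop hyb) hl (dropCoord_same _ _)
    (fun i hi hil => by rw [dropCoord_ne hil]; exact hy i hi) (dropCoord_same _ _)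

end Face

/-! ### Local representatives of stratified vector fields -/

lemma convex_modelCorner (k : ℕ) : Convex ℝ (modelCorner m k) := by
  intro x hx y hy a b ha hb _ i hi
  have h1 := mul_nonneg ha (hx i hi)
  have h2 := mul_nonneg hb (hy i hi)
  simp only [PiLp.add_apply, PiLp.smul_apply, smul_eq_mul]
  linarith

section LocalRep

variable [IsManifold (𝓡 m) ω X] {M : Set X} {k : ℕ} {φ : OpenPartialHomeomorph X 𝔼[m]}
  {η : (p : X) → TangentSpace (𝓡 m) p}

lemma IsStratifiedField.contDiffWithinAt_localRep (hη : IsStratifiedField M η)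
    (hφ : IsEnvelopingChart M k φ) {x : 𝔼[m]} (hx : x ∈ φ.target) (hxc : x ∈ modelCorner m k) :
    ContDiffWithinAt ℝ ω (localRep φ η) (modelCorner m k) x := by
  have h1 : ContMDiffOn (𝓡 m) (𝓡 m).tangent ω
      (fun y => (⟨φ.symm y, η (φ.symm y)⟩ : TangentBundle (𝓡 m) X))
      (φ.target ∩ modelCorner m k) :=
    hη.1.comp ((contMDiffOn_symm_of_mem_maximalAtlas hφ.2.1).mono inter_subset_left)
      fun y hy => hφ.symm_mem hy.1 hy.2
  have h2 := (contMDiffOn_of_mem_maximalAtlas hφ.2.1).contMDiffOn_tangentMapWithin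
    (m := ω) (by simp) φ.open_source.uniqueMDiffOn
  have h3 := h2.comp h1 fun y hy => φ.map_target hy.1
  have h4 := (contMDiff_snd_tangentBundle_modelSpace 𝔼[m] (𝓡 m) (n := ω)).comp_contMDiffOn h3
  have h5 : ContDiffOn ℝ ω (localRep φ η) (φ.target ∩ modelCorner m k) := by
    rw [← contMDiffOn_iff_contDiffOn]
    refine h4.congr fun y hy => ?_
    exact (DFunLike.congr_fun (mfderivWithin_of_isOpen (I := 𝓡 m) (I' := 𝓡 m) (f := φ)
      φ.open_source (φ.map_target hy.1)) (η (φ.symm y))).symm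
  exact (contDiffWithinAt_inter' (mem_nhdsWithin_of_mem_nhds (φ.open_target.mem_nhds hx))).1
    (by rw [inter_comm]; exact h5 x ⟨hx, hxc⟩)

lemma IsStratifiedField.localRep_apply_eq_zero (hη : IsStratifiedField M η)
    (hφ : IsEnvelopingChart M k φ) {x : 𝔼[m]} (hx : x ∈ φ.target) (hxc : x ∈ modelCorner m k)
    {l : Fin m} (hl : l.val < k) (hl0 : x l = 0) : localRep φ η x l = 0 :=
  hη.2 _ (hφ.symm_mem hx hxc) k φ hφ (φ.map_target hx) l hl (by rw [φ.right_inv hx]; exact hl0)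

omit [IsManifold (𝓡 m) ω X] in
lemma norm_le_of_c1Norm_lt {ε : ℝ} {f : 𝔼[m] → 𝔼[m]}
    (h : c1Norm k 1 f < ENNReal.ofReal ε) {x : 𝔼[m]}
    (hx : x ∈ Metric.closedBall (0 : 𝔼[m]) 1 ∩ modelCorner m k) :
    ‖f x‖ ≤ ε ∧ ‖fderivWithin ℝ f (modelCorner m k) x‖ ≤ ε := by
  have hε : 0 < ε := ENNReal.ofReal_pos.1 (lt_of_le_of_lt zero_le h)
  have h1 : ‖f x‖ₑ ≤ ENNReal.ofReal ε :=
    ((le_iSup₂ (f := fun y (_ : y ∈ Metric.closedBall (0 : 𝔼[m]) 1 ∩ modelCorner m k) => ‖f y‖ₑ)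
      x hx).trans (le_max_left _ _)).trans h.le
  have h2 : ‖fderivWithin ℝ f (modelCorner m k) x‖ₑ ≤ ENNReal.ofReal ε :=
    ((le_iSup₂ (f := fun y (_ : y ∈ Metric.closedBall (0 : 𝔼[m]) 1 ∩ modelCorner m k) =>
      ‖fderivWithin ℝ f (modelCorner m k) y‖ₑ) x hx).trans (le_max_right _ _)).trans h.le
  rw [← ofReal_norm] at h1 h2
  exact ⟨(ENNReal.ofReal_le_ofReal_iff hε.le).1 h1, (ENNReal.ofReal_le_ofReal_iff hε.le).1 h2⟩

/-- A stratified field with small `C¹` norm in a chart is small in the sense needed for corner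
flows; its normal components are estimated along the segments orthogonal to the faces. -/
lemma IsStratifiedField.isSmallField (hη : IsStratifiedField M η) (hφ : IsEnvelopingChart M k φ)
    (hφt : φ.target = Metric.ball 0 5) {ε : ℝ}
    (h : c1Norm k 1 (localRep φ η) < ENNReal.ofReal ε) {x₀ : 𝔼[m]} {r : ℝ}
    (hr : Metric.ball x₀ r ⊆ Metric.ball 0 1) : IsSmallField k x₀ r ε (localRep φ η) := by
  set s : Set 𝔼[m] := Metric.closedBall (0 : 𝔼[m]) 1 ∩ modelCorner m k with hs
  have hst {x : 𝔼[m]} (hx : x ∈ s) : x ∈ φ.target := by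
    rw [hφt]
    exact Metric.closedBall_subset_ball (by norm_num) hx.1
  have hsub : Metric.ball x₀ r ∩ modelCorner m k ⊆ s :=
    inter_subset_inter_left _ (hr.trans Metric.ball_subset_closedBall)
  have hlip {x y : 𝔼[m]} (hx : x ∈ s) (hy : y ∈ s) :
      ‖localRep φ η x - localRep φ η y‖ ≤ ε * ‖x - y‖ :=
    Convex.norm_image_sub_le_of_norm_hasFDerivWithin_le
      (f' := fderivWithin ℝ (localRep φ η) (modelCorner m k))
      (fun z hz => (((hη.contDiffWithinAt_localRep hφ (hst hz) hz.2).differentiableWithinAt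
        (by simp)).hasFDerivWithinAt).mono inter_subset_right)
      (fun z hz => (norm_le_of_c1Norm_lt h hz).2)
      ((convex_closedBall _ _).inter (convex_modelCorner k)) hy hx
  refine ⟨fun x hx => (norm_le_of_c1Norm_lt h (hsub hx)).1,
    fun x hx x' hx' => hlip (hsub hx) (hsub hx'), fun x hx l hl => ?_⟩
  have hxs := hsub hx
  have hds : dropCoord l x ∈ s := by
    refine ⟨?_, fun i hi => ?_⟩
    · have := hxs.1
      rw [mem_closedBall_zero_iff] at this ⊢
      exact (norm_dropCoord_le l x).trans this
    · by_cases hil : i = l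
      · rw [hil, dropCoord_same]
      · rw [dropCoord_ne hil]
        exact hxs.2 i hi
  have h0 := hη.localRep_apply_eq_zero hφ (hst hds) hds.2 hl (dropCoord_same l x)
  have h1 := (abs_coord_le_norm _ l).trans (hlip hxs hds)
  rw [PiLp.sub_apply, h0, sub_zero, norm_sub_dropCoord, abs_of_nonneg (hxs.2 l hl)] at h1
  exact h1

end LocalRep

/-! ### The map `ψ_η` near a point -/

section Adapted

variable [IsManifold (𝓡 m) ω X]

/-- An enveloping chart with a corner flow of the spray around `x₀`, to which the field `η` is
small enough for the local estimates to hold. -/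
structure IsAdapted (g : AnalyticMetric m X) (M : Set X) (η : (p : X) → TangentSpace (𝓡 m) p)
    (k : ℕ) (φ : OpenPartialHomeomorph X 𝔼[m]) (x₀ : 𝔼[m]) (W : Set (𝔼[m] × 𝔼[m]))
    (U : 𝔼[m] × 𝔼[m] → C(TimeInterval, 𝔼[m] × 𝔼[m])) (r ε : ℝ) : Prop where
  chart : IsEnvelopingChart M k φ
  flow : IsCornerFlow k (chartSpray g φ) x₀ W U r
  mem_target : ∀ w ∈ W, w.1 ∈ φ.target
  stratified : IsStratifiedField M η
  small : IsSmallField k x₀ r ε (localRep φ η)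
  le_div : ε ≤ r / 8
  le_quarter : ε ≤ 1 / 4

namespace IsAdapted

variable {g : AnalyticMetric m X} {M : Set X} {η : (p : X) → TangentSpace (𝓡 m) p}
    {k : ℕ} {φ : OpenPartialHomeomorph X 𝔼[m]} {x₀ : 𝔼[m]} {W : Set (𝔼[m] × 𝔼[m])}
    {U : 𝔼[m] × 𝔼[m] → C(TimeInterval, 𝔼[m] × 𝔼[m])} {r ε : ℝ} {x : 𝔼[m]}

lemma lt (h : IsAdapted g M η k φ x₀ W U r ε) : ε < r := by
  have := h.flow.pos
  linarith [h.le_div]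

lemma init_mem (h : IsAdapted g M η k φ x₀ W U r ε)
    (hx : x ∈ Metric.ball x₀ r ∩ modelCorner m k) :
    (x, localRep φ η x) ∈ Metric.ball (x₀, (0 : 𝔼[m])) r :=
  IsSmallField.mem_ball h.small h.lt hx

lemma path_mem_target (h : IsAdapted g M η k φ x₀ W U r ε)
    (hx : x ∈ Metric.ball x₀ r ∩ modelCorner m k) (t : ℝ) :
    (pathExt (U (x, localRep φ η x)) t).1 ∈ φ.target :=
  h.mem_target _ (h.flow.mem _ (h.init_mem hx) t)

lemma mem_chart_target (h : IsAdapted g M η k φ x₀ W U r ε)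
    (hx : x ∈ Metric.ball x₀ r ∩ modelCorner m k) : x ∈ φ.target := by
  have := h.path_mem_target hx 0
  rwa [h.flow.init _ (h.init_mem hx)] at this

lemma mem_expDomain (h : IsAdapted g M η k φ x₀ W U r ε)
    (hx : x ∈ Metric.ball x₀ r ∩ modelCorner m k) :
    (⟨φ.symm x, η (φ.symm x)⟩ : TangentBundle (𝓡 m) X) ∈ expDomain g :=
  ⟨_, h.flow.isExpValue h.chart.2.1 h.mem_target η (h.init_mem hx)⟩

lemma psi_eq [T2Space X] (h : IsAdapted g M η k φ x₀ W U r ε)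
    (hx : x ∈ Metric.ball x₀ r ∩ modelCorner m k) :
    psi g η (φ.symm x) = φ.symm (pathExt (U (x, localRep φ η x)) 1).1 :=
  h.flow.riemExp_eq h.chart.2.1 h.mem_target η (h.init_mem hx)

lemma path_mem_stratum (h : IsAdapted g M η k φ x₀ W U r ε)
    (hx : x ∈ Metric.ball x₀ r ∩ modelCorner m k) {t : ℝ} (ht : t ∈ Icc (0 : ℝ) 1) {j : ℕ} :
    φ.symm (pathExt (U (x, localRep φ η x)) t).1 ∈ stratum m M j ↔ φ.symm x ∈ stratum m M j := by
  have h1 := h.path_mem_target hx t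
  have h2 := h.mem_chart_target hx
  have h3 := h.flow.mem_modelCorner h.small h.lt h.le_quarter hx ht
  rw [h.chart.mem_stratum_iff (φ.map_target h1), h.chart.mem_stratum_iff (φ.map_target h2),
    φ.right_inv h1, φ.right_inv h2, h.flow.cornerIndex_eq h.small h.lt h.le_quarter hx ht]
  exact and_congr_left fun _ => iff_of_true (h.chart.symm_mem h1 h3) (h.chart.symm_mem h2 hx.2)

/-- A point and its image are joined by a geodesic in the stratum of the point. -/
lemma psi_mem_connectedComponentIn [T2Space X] (h : IsAdapted g M η k φ x₀ W U r ε)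
    (hx : x ∈ Metric.ball x₀ r ∩ modelCorner m k) {j : ℕ} (hj : φ.symm x ∈ stratum m M j) :
    psi g η (φ.symm x) ∈ connectedComponentIn (stratum m M j) (φ.symm x) := by
  set c : ℝ → 𝔼[m] := fun t => (pathExt (U (x, localRep φ η x)) t).1 with hc
  have hcont : ContinuousOn (fun t => φ.symm (c t)) (Icc 0 1) := by
    refine φ.continuousOn_symm.comp (t := φ.target) ?_ fun t _ => h.path_mem_target hx t
    exact (continuous_fst.comp (continuous_pathExt _)).continuousOn
  have hpre := isPreconnected_Icc.image _ hcont
  have h0 : φ.symm x ∈ (fun t => φ.symm (c t)) '' Icc 0 1 := by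
    refine ⟨0, by simp, ?_⟩
    simp only [hc]
    rw [h.flow.init _ (h.init_mem hx)]
  have hsub : (fun t => φ.symm (c t)) '' Icc 0 1 ⊆ stratum m M j := by
    rintro _ ⟨t, ht, rfl⟩
    exact (h.path_mem_stratum hx ht).2 hj
  rw [h.psi_eq hx]
  exact hpre.subset_connectedComponentIn h0 hsub ⟨1, by simp, rfl⟩

lemma psi_injective [T2Space X] (h : IsAdapted g M η k φ x₀ W U r ε) {x' : 𝔼[m]}
    (hx : x ∈ Metric.ball x₀ r ∩ modelCorner m k) (hx' : x' ∈ Metric.ball x₀ r ∩ modelCorner m k)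
    (heq : psi g η (φ.symm x) = psi g η (φ.symm x')) : x = x' := by
  rw [h.psi_eq hx, h.psi_eq hx'] at heq
  exact h.flow.injOn h.small h.lt h.le_quarter hx hx'
    (φ.symm.injOn (h.path_mem_target hx 1) (h.path_mem_target hx' 1) heq)

lemma exists_psi_eq [T2Space X] (h : IsAdapted g M η k φ x₀ W U r ε) {y : 𝔼[m]}
    (hy : y ∈ Metric.ball x₀ (r / 8) ∩ modelCorner m k) :
    ∃ x ∈ Metric.ball x₀ r ∩ modelCorner m k, psi g η (φ.symm x) = φ.symm y := by
  obtain ⟨x, hx, hxy⟩ := h.flow.exists_preimage h.small h.le_div h.le_quarter hy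
  exact ⟨x, hx, by rw [h.psi_eq hx, hxy]⟩

/-- The coordinate expression of `ψ_η` extends from the corner to an analytic map on a
neighbourhood. Its derivative is invertible: it differs from the identity by at most `1 / 2` at
interior points of the corner, hence by continuity at all points. -/
lemma exists_analytic_extension (h : IsAdapted g M η k φ x₀ W U r ε)
    (hx : x ∈ Metric.ball x₀ r ∩ modelCorner m k) :
    ∃ (f : 𝔼[m] → 𝔼[m]) (e : 𝔼[m] ≃L[ℝ] 𝔼[m]), ContDiffAt ℝ ω f x ∧
      HasFDerivAt f (e : 𝔼[m] →L[ℝ] 𝔼[m]) x ∧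
      ∀ᶠ y in 𝓝 x, y ∈ modelCorner m k → (pathExt (U (y, localRep φ η y)) 1).1 = f y := by
  have h1 := h.stratified.contDiffWithinAt_localRep h.chart (h.mem_chart_target hx) hx.2
  rw [contDiffWithinAt_omega_iff_analyticWithinAt, analyticWithinAt_iff_exists_analyticAt,
    insert_eq_of_mem hx.2] at h1
  obtain ⟨ξ, hξeq, hξ⟩ := h1
  have hξx : localRep φ η x = ξ x := hξeq.self_of_nhdsWithin hx.2
  let L : C(TimeInterval, 𝔼[m] × 𝔼[m]) →L[ℝ] 𝔼[m] := (ContinuousLinearMap.fst ℝ 𝔼[m] 𝔼[m]).comp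
    (ContinuousMap.evalCLM ℝ (projIcc (-1 : ℝ) 2 (by norm_num) 1))
  let f : 𝔼[m] → 𝔼[m] := fun y => L (U (y, ξ y))
  have hf : ContDiffAt ℝ ω f x := by
    have h2 : ContDiffAt ℝ ω (fun y => (y, ξ y)) x := contDiffAt_id.prodMk hξ.contDiffAt
    have h3 : ContDiffAt ℝ ω U (x, ξ x) := by
      have := h.flow.contDiffAt _ (h.init_mem hx)
      rwa [hξx] at this
    exact L.contDiff.contDiffAt.comp x (h3.comp x h2)
  have hfeq : ∀ᶠ y in 𝓝 x,
      y ∈ modelCorner m k → (pathExt (U (y, localRep φ η y)) 1).1 = f y := by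
    filter_upwards [eventually_nhdsWithin_iff.1 hξeq] with y hy hyc
    rw [hy hyc]
    rfl
  set D := fderiv ℝ f x with hD
  have hdiff : HasFDerivAt f D x := (hf.differentiableAt (by simp)).hasFDerivAt
  have hbound : ‖D - ContinuousLinearMap.id ℝ 𝔼[m]‖ ≤ 1 / 2 := by
    let u : 𝔼[m] := WithLp.toLp 2 fun _ => (1 : ℝ)
    have hline : Tendsto (fun a : ℝ => x + a • u) (𝓝[>] 0) (𝓝 x) := by
      have : Continuous fun a : ℝ => x + a • u := by fun_prop
      simpa using (this.tendsto 0).mono_left nhdsWithin_le_nhds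
    have hcont : Tendsto (fun y => ‖fderiv ℝ f y - ContinuousLinearMap.id ℝ 𝔼[m]‖) (𝓝 x)
        (𝓝 ‖D - ContinuousLinearMap.id ℝ 𝔼[m]‖) := by
      have h2 : ContDiffAt ℝ ω (fderiv ℝ f) x := hf.fderiv_right (by simp)
      exact (h2.continuousAt.sub continuousAt_const).norm
    refine le_of_tendsto (hcont.comp hline) ?_
    have hball : ∀ᶠ y in 𝓝 x, y ∈ Metric.ball x₀ r := Metric.isOpen_ball.mem_nhds hx.1
    have hdf : ∀ᶠ y in 𝓝 x, ContDiffAt ℝ ω f y := hf.eventually (by simp)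
    filter_upwards [hline.eventually (hfeq.and hball).eventually_nhds, hline.eventually hdf,
      self_mem_nhdsWithin] with a ha1 ha2 ha3
    have hint := eventually_coord_pos hx.2 (mem_Ioi.1 ha3)
    have hdfa : HasFDerivAt (fun y => f y - y) (fderiv ℝ f (x + a • u)
        - ContinuousLinearMap.id ℝ 𝔼[m]) (x + a • u) :=
      ((ha2.differentiableAt (by simp)).hasFDerivAt).sub (hasFDerivAt_id _)
    refine hdfa.le_of_lip' (by norm_num) ?_
    have hself := (ha1.and hint).self_of_nhds
    filter_upwards [ha1, hint] with y hy1 hy2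
    have h3 := h.flow.norm_sub_sub_le h.small h.lt h.le_quarter ⟨hy1.2, fun i hi => (hy2 i hi).le⟩
      ⟨hself.1.2, fun i hi => (hself.2 i hi).le⟩
    rw [hy1.1 fun i hi => (hy2 i hi).le, hself.1.1 fun i hi => (hself.2 i hi).le] at h3
    refine le_trans (le_of_eq (congrArg norm ?_)) h3
    abel
  have hinj : Function.Injective D.toLinearMap := by
    rw [injective_iff_map_eq_zero]
    intro v hv
    have h2 := (D - ContinuousLinearMap.id ℝ 𝔼[m]).le_of_opNorm_le hbound v
    have h3 : (D - ContinuousLinearMap.id ℝ 𝔼[m]) v = -v := by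
      rw [sub_apply, ContinuousLinearMap.id_apply]
      have : D v = 0 := hv
      rw [this, zero_sub]
    rw [h3, norm_neg] at h2
    exact norm_eq_zero.1 (by linarith [norm_nonneg v])
  refine ⟨f, (LinearEquiv.ofInjectiveEndo D.toLinearMap hinj).toContinuousLinearEquiv, hf, ?_,
    hfeq⟩
  convert hdiff using 1
  exact ContinuousLinearMap.ext fun v => rfl

lemma eventually_chart_mem (h : IsAdapted g M η k φ x₀ W U r ε)
    (hx : x ∈ Metric.ball x₀ r ∩ modelCorner m k) {P : 𝔼[m] → Prop} (hP : ∀ᶠ y in 𝓝 x, P y) :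
    ∀ᶠ p in 𝓝[M] (φ.symm x), p ∈ φ.source ∧ φ p ∈ Metric.ball x₀ r ∩ modelCorner m k ∧
      P (φ p) := by
  have hxt := h.mem_chart_target hx
  have hs := φ.map_target hxt
  have hc : Tendsto φ (𝓝 (φ.symm x)) (𝓝 x) := by
    have := (φ.continuousAt hs).tendsto
    rwa [φ.right_inv hxt] at this
  have h1 : ∀ᶠ y in 𝓝 x, y ∈ Metric.ball x₀ r := Metric.isOpen_ball.mem_nhds hx.1
  filter_upwards [mem_nhdsWithin_of_mem_nhds (φ.open_source.mem_nhds hs),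
    mem_nhdsWithin_of_mem_nhds (hc.eventually h1), mem_nhdsWithin_of_mem_nhds (hc.eventually hP),
    self_mem_nhdsWithin] with p hp1 hp2 hp3 hp4
  exact ⟨hp1, ⟨hp2, h.chart.apply_mem hp1 hp4⟩, hp3⟩

lemma contMDiffWithinAt_psi [T2Space X] (h : IsAdapted g M η k φ x₀ W U r ε)
    (hx : x ∈ Metric.ball x₀ r ∩ modelCorner m k) :
    ContMDiffWithinAt (𝓡 m) (𝓡 m) ω (psi g η) M (φ.symm x) := by
  obtain ⟨f, -, hf, -, hfeq⟩ := h.exists_analytic_extension hx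
  have hxt := h.mem_chart_target hx
  have hs := φ.map_target hxt
  have hfx : (pathExt (U (x, localRep φ η x)) 1).1 = f x := hfeq.self_of_nhds hx.2
  have hfx' : f x ∈ φ.target := hfx ▸ h.path_mem_target hx 1
  have hcomp : ContMDiffAt (𝓡 m) (𝓡 m) ω (fun p => φ.symm (f (φ p))) (φ.symm x) := by
    refine ContMDiffAt.comp (I' := 𝓡 m) (φ.symm x) (g := φ.symm) (f := fun p => f (φ p)) ?_ ?_
    · rw [φ.right_inv hxt]
      exact contMDiffAt_symm_of_mem_maximalAtlas h.chart.2.1 hfx'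
    · refine ContMDiffAt.comp (I' := 𝓡 m) (φ.symm x) (g := f) (f := φ) ?_
        (contMDiffAt_of_mem_maximalAtlas h.chart.2.1 hs)
      rw [φ.right_inv hxt]
      exact hf.contMDiffAt
  have heq : ∀ᶠ p in 𝓝[M] (φ.symm x), psi g η p = φ.symm (f (φ p)) := by
    filter_upwards [h.eventually_chart_mem hx hfeq] with p ⟨hp1, hp2, hp3⟩
    rw [← hp3 hp2.2, ← h.psi_eq hp2, φ.left_inv hp1]
  exact hcomp.contMDiffWithinAt.congr_of_eventuallyEq heq
    (heq.self_of_nhdsWithin (h.chart.symm_mem hxt hx.2))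

/-- A continuous right inverse of `ψ_η` on `M` is analytic. -/
lemma contMDiffWithinAt_of_rightInverse [T2Space X] (h : IsAdapted g M η k φ x₀ W U r ε)
    (hx : x ∈ Metric.ball x₀ r ∩ modelCorner m k) {σ : X → X} {q : X} (hq : q ∈ M)
    (hσM : MapsTo σ M M) (hσ : ∀ p ∈ M, psi g η (σ p) = p) (hσc : ContinuousWithinAt σ M q)
    (hσq : σ q = φ.symm x) : ContMDiffWithinAt (𝓡 m) (𝓡 m) ω σ M q := by
  obtain ⟨f, e, hf, hfe, hfeq⟩ := h.exists_analytic_extension hx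
  have hω : (ω : WithTop ℕ∞) ≠ 0 := by simp
  have hxt := h.mem_chart_target hx
  have hfx : (pathExt (U (x, localRep φ η x)) 1).1 = f x := hfeq.self_of_nhds hx.2
  have hfx' : f x ∈ φ.target := hfx ▸ h.path_mem_target hx 1
  have hqf : q = φ.symm (f x) := by rw [← hfx, ← h.psi_eq hx, ← hσq, hσ q hq]
  have hqs : q ∈ φ.source := hqf ▸ φ.map_target hfx'
  have hφq : φ q = f x := by rw [hqf, φ.right_inv hfx']
  let τ := hf.localInverse hfe hω
  have hτ : ContDiffAt ℝ ω τ (f x) := hf.to_localInverse hfe hω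
  have hτx : τ (f x) = x := hf.localInverse_apply_image hfe hω
  have hτl : ∀ᶠ y in 𝓝 x, τ (f y) = y := (hf.hasStrictFDerivAt' hfe hω).eventually_left_inverse
  have hcomp : ContMDiffAt (𝓡 m) (𝓡 m) ω (fun p => φ.symm (τ (φ p))) q := by
    refine ContMDiffAt.comp (I' := 𝓡 m) q (g := φ.symm) (f := fun p => τ (φ p)) ?_ ?_
    · rw [hφq, hτx]
      exact contMDiffAt_symm_of_mem_maximalAtlas h.chart.2.1 hxt
    · refine ContMDiffAt.comp (I' := 𝓡 m) q (g := τ) (f := φ) ?_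
        (contMDiffAt_of_mem_maximalAtlas h.chart.2.1 hqs)
      rw [hφq]
      exact hτ.contMDiffAt
  have htend : Tendsto σ (𝓝[M] q) (𝓝[M] (φ.symm x)) := by
    rw [← hσq]
    exact hσc.tendsto_nhdsWithin hσM
  have heq : ∀ᶠ p in 𝓝[M] q, σ p = φ.symm (τ (φ p)) := by
    filter_upwards [htend.eventually (h.eventually_chart_mem hx (hfeq.and hτl)),
      self_mem_nhdsWithin] with p ⟨hp1, hp2, hp3, hp4⟩ hpM
    have h1 : φ.symm (f (φ (σ p))) = p := by
      rw [← hp3 hp2.2, ← h.psi_eq hp2, φ.left_inv hp1, hσ p hpM]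
    have h2 : f (φ (σ p)) ∈ φ.target := by
      rw [← hp3 hp2.2]
      exact h.path_mem_target hp2 1
    have h3 : φ p = f (φ (σ p)) := by
      conv_lhs => rw [← h1]
      exact φ.right_inv h2
    rw [h3, hp4, φ.left_inv hp1]
  exact hcomp.contMDiffWithinAt.congr_of_eventuallyEq heq (heq.self_of_nhdsWithin hq)

end IsAdapted

end Adapted

/-! ### From local to global -/

section Global

variable [IsManifold (𝓡 m) ω X] {g : AnalyticMetric m X} {M : Set X}
  {η : (p : X) → TangentSpace (𝓡 m) p}

/-- Some adapted chart is centred so close to `p` that the local estimates apply at `p`, including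
the construction of a preimage of `p`. -/
def HasAdaptedChart (g : AnalyticMetric m X) (M : Set X) (η : (p : X) → TangentSpace (𝓡 m) p)
    (p : X) : Prop :=
  ∃ k φ x₀ W U r ε, IsAdapted g M η k φ x₀ W U r ε ∧ p ∈ φ.source ∧
    φ p ∈ Metric.ball x₀ (r / 8)

lemma HasAdaptedChart.exists_symm_eq {p : X} (h : HasAdaptedChart g M η p) (hp : p ∈ M) :
    ∃ k φ x₀ W U r ε x, IsAdapted g M η k φ x₀ W U r ε ∧
      x ∈ Metric.ball x₀ (r / 8) ∩ modelCorner m k ∧ x ∈ Metric.ball x₀ r ∩ modelCorner m k ∧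
      p = φ.symm x := by
  obtain ⟨k, φ, x₀, W, U, r, ε, h, hps, hpr⟩ := h
  have hr := h.flow.pos
  have hc := h.chart.apply_mem hps hp
  exact ⟨k, φ, x₀, W, U, r, ε, φ p, h, ⟨hpr, hc⟩,
    ⟨Metric.ball_subset_ball (by linarith) hpr, hc⟩, (φ.left_inv hps).symm⟩

omit [IsManifold (𝓡 m) ω X] in
lemma exists_mem_stratum (hM : IsEnveloped m M) {p : X} (hp : p ∈ M) :
    ∃ j, p ∈ stratum m M j := by
  obtain ⟨k, φ, hφ, hps⟩ := hM p hp
  exact ⟨_, hp, k, φ, hφ, hps, rfl⟩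

variable [T2Space X]

lemma psi_mem_connectedComponentIn_stratum (h : ∀ p ∈ M, HasAdaptedChart g M η p) {j : ℕ} {p : X}
    (hp : p ∈ stratum m M j) : psi g η p ∈ connectedComponentIn (stratum m M j) p := by
  obtain ⟨k, φ, x₀, W, U, r, ε, x, h, -, hx, rfl⟩ := (h p hp.1).exists_symm_eq hp.1
  exact h.psi_mem_connectedComponentIn hx hp

/-- Every point of a stratum is the image of a point of the same stratum. -/
lemma exists_mem_stratum_psi_eq (h : ∀ p ∈ M, HasAdaptedChart g M η p) {j : ℕ} {q : X}
    (hq : q ∈ stratum m M j) : ∃ p ∈ stratum m M j, psi g η p = q := by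
  obtain ⟨k, φ, x₀, W, U, r, ε, y, h, hy, -, rfl⟩ := (h q hq.1).exists_symm_eq hq.1
  obtain ⟨x, hx, hxy⟩ := h.exists_psi_eq hy
  refine ⟨φ.symm x, ?_, hxy⟩
  rwa [← h.path_mem_stratum hx (t := 1) (by simp), ← h.psi_eq hx, hxy]

lemma image_psi_stratum (h : ∀ p ∈ M, HasAdaptedChart g M η p) (j : ℕ) :
    psi g η '' stratum m M j = stratum m M j := by
  refine Subset.antisymm ?_ fun q hq => exists_mem_stratum_psi_eq h hq
  rintro _ ⟨p, hp, rfl⟩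
  exact connectedComponentIn_subset _ _ (psi_mem_connectedComponentIn_stratum h hp)

lemma image_psi_connectedComponentIn (h : ∀ p ∈ M, HasAdaptedChart g M η p) (j : ℕ) (p : X) :
    psi g η '' connectedComponentIn (stratum m M j) p =
      connectedComponentIn (stratum m M j) p := by
  refine Subset.antisymm ?_ fun q hq => ?_
  · rintro _ ⟨q, hq, rfl⟩
    rw [connectedComponentIn_eq hq]
    exact psi_mem_connectedComponentIn_stratum h (connectedComponentIn_subset _ _ hq)
  · obtain ⟨p', hp', rfl⟩ := exists_mem_stratum_psi_eq h (connectedComponentIn_subset _ _ hq)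
    refine ⟨p', ?_, rfl⟩
    rw [connectedComponentIn_eq hq,
      ← connectedComponentIn_eq (psi_mem_connectedComponentIn_stratum h hp')]
    exact mem_connectedComponentIn hp'

/-- A continuous bijection of a compact set has a continuous inverse, so analyticity of the inverse
is a local matter. -/
lemma isAnalyticDiffeoOf_psi (hMc : IsCompact M) (hM : IsEnveloped m M)
    (h : ∀ p ∈ M, HasAdaptedChart g M η p) (hinj : InjOn (psi g η) M) :
    IsAnalyticDiffeoOf m M (psi g η) := by
  have hmaps : MapsTo (psi g η) M M := fun p hp => by
    obtain ⟨j, hj⟩ := exists_mem_stratum hM hp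
    exact (connectedComponentIn_subset _ _ (psi_mem_connectedComponentIn_stratum h hj)).1
  have hana : ContMDiffOn (𝓡 m) (𝓡 m) ω (psi g η) M := fun p hp => by
    obtain ⟨k, φ, x₀, W, U, r, ε, x, h, -, hx, rfl⟩ := (h p hp).exists_symm_eq hp
    exact h.contMDiffWithinAt_psi hx
  have hsurj : ∀ q, ∃ p, q ∈ M → p ∈ M ∧ psi g η p = q := fun q => by
    by_cases hq : q ∈ M
    · obtain ⟨j, hj⟩ := exists_mem_stratum hM hq
      obtain ⟨p, hp, hpq⟩ := exists_mem_stratum_psi_eq h hj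
      exact ⟨p, fun _ => ⟨hp.1, hpq⟩⟩
    · exact ⟨q, fun h => absurd h hq⟩
  choose σ hσ using hsurj
  have hσM : MapsTo σ M M := fun q hq => (hσ q hq).1
  have hσr : ∀ q ∈ M, psi g η (σ q) = q := fun q hq => (hσ q hq).2
  have hσl : ∀ p ∈ M, σ (psi g η p) = p := fun p hp =>
    hinj (hσM (hmaps hp)) hp (hσr _ (hmaps hp))
  have hσc : ContinuousOn σ M := by
    rw [continuousOn_iff_continuous_domRestrict, continuous_iff_isClosed]
    intro C hC
    have h1 : IsClosed (psi g η '' (M ∩ C)) :=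
      ((hMc.inter_right hC).image_of_continuousOn
        (hana.continuousOn.mono inter_subset_left)).isClosed
    convert h1.preimage (continuous_subtype_val (p := (· ∈ M))) using 1
    ext ⟨q, hq⟩
    simp only [mem_preimage, domRestrict_apply, mem_image]
    constructor
    · exact fun hqC => ⟨σ q, ⟨hσM hq, hqC⟩, hσr q hq⟩
    · rintro ⟨p, ⟨hpM, hpC⟩, rfl⟩
      rwa [hσl p hpM]
  refine ⟨hmaps, hana, σ, hσM, fun q hq => ?_, hσl, hσr⟩
  obtain ⟨k, φ, x₀, W, U, r, ε, x, h, -, hx, hσx⟩ := (h _ (hσM hq)).exists_symm_eq (hσM hq)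
  exact h.contMDiffWithinAt_of_rightInverse hx hq hσM hσr (hσc q hq) hσx

end Global

section Uniform

variable [IsManifold (𝓡 m) ω X] {g : AnalyticMetric m X} {M : Set X}
  {ι : Type*} {k : ι → ℕ} {φ : ι → OpenPartialHomeomorph X 𝔼[m]}

/-- Around each point of `M` there is an adapted chart, the same for all fields that are small
enough, in which the geodesics stay in a prescribed neighbourhood `O`. -/
lemma exists_isAdapted (hg : BoundaryRespecting g M) (hφ : ∀ i, IsEnvelopingChart M (k i) (φ i))
    (hφt : ∀ i, (φ i).target = Metric.ball 0 5)
    (hφM : M ⊆ ⋃ i, (φ i).source ∩ (φ i) ⁻¹' Metric.ball 0 1) {p : X} (hp : p ∈ M) {O : Set X}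
    (hO : O ∈ 𝓝 p) :
    ∃ i W U r, 0 < r ∧ p ∈ (φ i).source ∧ (∀ w ∈ W, (φ i).symm w.1 ∈ O) ∧
      ∀ᶠ ε in 𝓝 (0 : ℝ), ∀ η : (p : X) → TangentSpace (𝓡 m) p, IsStratifiedField M η →
        (∀ i, c1Norm (k i) 1 (localRep (φ i) η) < ENNReal.ofReal ε) →
        IsAdapted g M η (k i) (φ i) (φ i p) W U r ε := by
  -- The radius is chosen such that the ball lies in the unit ball, on which the norms control `η`.
  obtain ⟨i, hps, hp1⟩ := mem_iUnion.1 (hφM hp)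
  have hx₀t := (φ i).map_source hps
  have hx₀c := (hφ i).apply_mem hps hp
  set x₀ := φ i p with hx₀
  let W : Set (𝔼[m] × 𝔼[m]) := Prod.fst ⁻¹' ((φ i).target ∩ (φ i).symm ⁻¹' O)
  have hW : W ∈ 𝓝 (x₀, (0 : 𝔼[m])) := by
    refine continuous_fst.continuousAt.preimage_mem_nhds ?_
    refine inter_mem ((φ i).open_target.mem_nhds hx₀t) ?_
    refine ((φ i).continuousAt_symm hx₀t).preimage_mem_nhds ?_
    rwa [hx₀, (φ i).left_inv hps]
  obtain ⟨U, r, hflow⟩ := exists_isCornerFlow hx₀c (contDiffAt_chartSpray (g := g) (hφ i).2.1 hx₀t)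
    (fun l hl hl0 => eventually_chartSpray_normal_eq_zero
      (hg 1 le_rfl (Nat.succ_le_of_lt l.pos)) (hφ i) hx₀t hx₀c hl hl0) hW
  obtain ⟨ρ, hρ, hρs⟩ := Metric.isOpen_ball.mem_nhds hp1 |> Metric.mem_nhds_iff.1
  have hr : 0 < min r ρ := lt_min hflow.pos hρ
  refine ⟨i, W, U, min r ρ, hr, hps, fun w hw => hw.2, ?_⟩
  filter_upwards [gt_mem_nhds (show 0 < min r ρ / 8 by positivity),
    gt_mem_nhds (show (0 : ℝ) < 1 / 4 by norm_num)] with ε hε1 hε2 η hη hηε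
  exact ⟨hφ i, hflow.mono hr (min_le_left _ _), fun w hw => hw.1, hη,
    hη.isSmallField (hφ i) (hφt i) (hηε i)
      ((Metric.ball_subset_ball (min_le_right _ _)).trans hρs), hε1.le, hε2.le⟩

/-- By compactness, one bound on the norms provides adapted charts at all points of `M`. -/
lemma eventually_hasAdaptedChart (hMc : IsCompact M) (hg : BoundaryRespecting g M)
    (hφ : ∀ i, IsEnvelopingChart M (k i) (φ i)) (hφt : ∀ i, (φ i).target = Metric.ball 0 5)
    (hφM : M ⊆ ⋃ i, (φ i).source ∩ (φ i) ⁻¹' Metric.ball 0 1) :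
    ∀ᶠ ε in 𝓝 (0 : ℝ), ∀ p ∈ M, ∀ η : (p : X) → TangentSpace (𝓡 m) p, IsStratifiedField M η →
      (∀ i, c1Norm (k i) 1 (localRep (φ i) η) < ENNReal.ofReal ε) → HasAdaptedChart g M η p := by
  refine hMc.eventually_forall_of_forall_eventually fun p hp => ?_
  obtain ⟨i, W, U, r, hr, hps, -, hε⟩ := exists_isAdapted hg hφ hφt hφM hp univ_mem
  have h1 : ∀ᶠ q in 𝓝 p, q ∈ (φ i).source := (φ i).open_source.mem_nhds hps
  have h2 : ∀ᶠ q in 𝓝 p, φ i q ∈ Metric.ball (φ i p) (r / 8) :=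
    ((φ i).continuousAt hps).eventually (Metric.ball_mem_nhds _ (by positivity))
  rw [nhds_prod_eq]
  filter_upwards [hε.prod_mk (h1.and h2)] with z hz η hη hηε
  exact ⟨_, _, _, _, _, _, _, hz.1 η hη hηε, hz.2⟩

/-- For small fields, `ψ_η` is injective on `M`: near a point of the diagonal of `M × M` this is a
local estimate, and distinct points have disjoint neighbourhoods that contain the images of points
near them. -/
lemma eventually_injOn_psi [T2Space X] (hMc : IsCompact M) (hg : BoundaryRespecting g M)
    (hφ : ∀ i, IsEnvelopingChart M (k i) (φ i)) (hφt : ∀ i, (φ i).target = Metric.ball 0 5)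
    (hφM : M ⊆ ⋃ i, (φ i).source ∩ (φ i) ⁻¹' Metric.ball 0 1) :
    ∀ᶠ ε in 𝓝 (0 : ℝ), ∀ z ∈ M ×ˢ M, ∀ η : (p : X) → TangentSpace (𝓡 m) p,
      IsStratifiedField M η → (∀ i, c1Norm (k i) 1 (localRep (φ i) η) < ENNReal.ofReal ε) →
      z.1 ∈ M → z.2 ∈ M → psi g η z.1 = psi g η z.2 → z.1 = z.2 := by
  have hloc {p : X} (hp : p ∈ M) {O : Set X} (hO : O ∈ 𝓝 p) :
      ∃ i W U r, (∀ w ∈ W, (φ i).symm w.1 ∈ O) ∧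
        (∀ᶠ q in 𝓝 p, q ∈ (φ i).source ∧ φ i q ∈ Metric.ball (φ i p) r) ∧
        ∀ᶠ ε in 𝓝 (0 : ℝ), ∀ η : (p : X) → TangentSpace (𝓡 m) p, IsStratifiedField M η →
          (∀ i, c1Norm (k i) 1 (localRep (φ i) η) < ENNReal.ofReal ε) →
          IsAdapted g M η (k i) (φ i) (φ i p) W U r ε := by
    obtain ⟨i, W, U, r, hr, hps, hWO, hε⟩ := exists_isAdapted hg hφ hφt hφM hp hO
    have h1 : ∀ᶠ q in 𝓝 p, q ∈ (φ i).source := (φ i).open_source.mem_nhds hps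
    exact ⟨i, W, U, r, hWO,
      h1.and (((φ i).continuousAt hps).eventually (Metric.ball_mem_nhds _ hr)), hε⟩
  refine (hMc.prod hMc).eventually_forall_of_forall_eventually ?_
  rintro ⟨p, q⟩ ⟨hp, hq⟩
  rw [nhds_prod_eq, nhds_prod_eq]
  by_cases hpq : p = q
  · obtain rfl : p = q := hpq
    obtain ⟨i, W, U, r, -, h1, hε⟩ := hloc hp univ_mem
    filter_upwards [hε.prod_mk (h1.prod_mk h1)] with z hz η hη hηε hz1 hz2 heq
    obtain ⟨hz0, ⟨ha, ha'⟩, hb, hb'⟩ := hz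
    have had := hz0 η hη hηε
    rw [← (φ i).left_inv ha, ← (φ i).left_inv hb] at heq
    exact (φ i).injOn ha hb (had.psi_injective ⟨ha', had.chart.apply_mem ha hz1⟩
      ⟨hb', had.chart.apply_mem hb hz2⟩ heq)
  · obtain ⟨O, O', hO, hO', hdisj⟩ := t2_separation_nhds hpq
    obtain ⟨i, W, U, r, hWO, h1, hε⟩ := hloc hp hO
    obtain ⟨i', W', U', r', hWO', h1', hε'⟩ := hloc hq hO'
    filter_upwards [(hε.and hε').prod_mk (h1.prod_mk h1')] with z hz η hη hηε hz1 hz2 heq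
    obtain ⟨⟨hz0, hz0'⟩, ⟨ha, ha'⟩, hb, hb'⟩ := hz
    have had := hz0 η hη hηε
    have had' := hz0' η hη hηε
    have hx := And.intro ha' (had.chart.apply_mem ha hz1)
    have hx' := And.intro hb' (had'.chart.apply_mem hb hz2)
    rw [← (φ i).left_inv ha, ← (φ i').left_inv hb, had.psi_eq hx, had'.psi_eq hx'] at heq
    have hm := hWO _ (had.flow.mem _ (had.init_mem hx) 1)
    have hm' := hWO' _ (had'.flow.mem _ (had'.init_mem hx') 1)
    rw [heq] at hm
    exact absurd hm' (disjoint_left.1 hdisj hm)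

end Uniform

end CornerDiff

end

theorem mainTheorem4 {m : ℕ} {X : Type*} [TopologicalSpace X] [T2Space X]
    [ChartedSpace (EuclideanSpace ℝ (Fin m)) X] [IsManifold (𝓡 m) ω X]
    (M : Set X) (hMc : IsCompact M) (hM : CornerDiff.IsEnveloped m M)
    (g : CornerDiff.AnalyticMetric m X) (hg : CornerDiff.BoundaryRespecting g M)
    {ι : Type*} [Finite ι] (k : ι → ℕ)
    (φ : ι → OpenPartialHomeomorph X (EuclideanSpace ℝ (Fin m)))
    (hφ : ∀ i, CornerDiff.IsEnvelopingChart M (k i) (φ i))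
    (hφt : ∀ i, (φ i).target = Metric.ball 0 5)
    (hφM : M ⊆ ⋃ i, (φ i).source ∩ (φ i) ⁻¹' Metric.ball 0 1) :
    ∀ ε₀ : ℝ, 0 < ε₀ → ∃ ε : ℝ, 0 < ε ∧ ε < ε₀ ∧
      ∀ η : (p : X) → TangentSpace (𝓡 m) p,
        CornerDiff.IsStratifiedField M η →
        (∀ i, CornerDiff.c1Norm (k i) 1 (CornerDiff.localRep (φ i) η) < ENNReal.ofReal ε) →
        (∀ p ∈ M, (⟨p, η p⟩ : TangentBundle (𝓡 m) X) ∈ CornerDiff.expDomain g) ∧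
        CornerDiff.IsAnalyticDiffeoOf m M (CornerDiff.psi g η) ∧
        (∀ j : ℕ, CornerDiff.psi g η '' CornerDiff.stratum m M j = CornerDiff.stratum m M j) ∧
        ∀ j : ℕ, ∀ p ∈ CornerDiff.stratum m M j,
          CornerDiff.psi g η '' connectedComponentIn (CornerDiff.stratum m M j) p =
            connectedComponentIn (CornerDiff.stratum m M j) p := by
  intro ε₀ hε₀
  have hev : ∀ᶠ ε in 𝓝[>] (0 : ℝ), _ :=
    (((CornerDiff.eventually_hasAdaptedChart hMc hg hφ hφt hφM).and
      (CornerDiff.eventually_injOn_psi hMc hg hφ hφt hφM)).and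
        (gt_mem_nhds hε₀)).filter_mono nhdsWithin_le_nhds
  obtain ⟨ε, ⟨⟨hchart, hinj⟩, hlt⟩, hpos⟩ := (hev.and self_mem_nhdsWithin).exists
  refine ⟨ε, hpos, hlt, fun η hη hηε => ?_⟩
  have h : ∀ p ∈ M, CornerDiff.HasAdaptedChart g M η p := fun p hp => hchart p hp η hη hηε
  refine ⟨fun p hp => ?_, CornerDiff.isAnalyticDiffeoOf_psi hMc hM h fun p hp q hq hpq =>
    hinj (p, q) ⟨hp, hq⟩ η hη hηε hp hq hpq, CornerDiff.image_psi_stratum h,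
    fun j p _ => CornerDiff.image_psi_connectedComponentIn h j p⟩
  obtain ⟨_, φ, _, _, _, _, _, x, had, -, hx, rfl⟩ := (h p hp).exists_symm_eq hp
  exact had.mem_expDomain hx
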